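/- Let $d\ge 2$ and $0\le k\le d$ be integers and let $\sigma>0$. Let $X$ be a random vector in $\mathbb{R}^d$ with $\mathbb{E}X=0$, $\mathbb{E}\left[|X|^2\right]=\sigma^2 d$ and $A:=\mathbb{E}\left||X|^2\sigma^{-2}-d\right|<\infty$, where $|\cdot|$ is the Euclidean norm. Let $\mathfrak{W}_{d,k}$ be the Stiefel manifold of $k$-tuples $\theta=(\theta_1,\ldots,\theta_k)$ of orthonormal vectors of $\mathbb{R}^d$, let $\theta$ be a random point of $\mathfrak{W}_{d,k}$ that is independent of $X$ and distributed according to Haar measure (the unique Borel probability measure on $\mathfrak{W}_{d,k}$ invariant under $(\theta_1,\ldots,\theta_k)\mapsto(U\theta_1,\ldots,U\theta_k)$ for all orthogonal $U$), and set $$X_\theta:=\big(\langle X,\theta_1\rangle,\ldots,\langle X,\theta_k\rangle\big)\in\mathbb{R}^k .$$ Let $Z$ be a standard normal random vector in $\mathbb{R}^k$. Then $$d_W(X_\theta,\sigma Z)\le\frac{\sigma\sqrt{k}\,(A+1)+\sigma k}{d-1},$$ where $d_W(V,W)=\sup\big\{|\mathbb{E}f(W)-\mathbb{E}f(V)| :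 f:\mathbb{R}^k\to\mathbb{R},\ |f(x)-f(y)|\le|x-y|\text{ for all }x,y\big\}$ is the Wasserstein distance, and the law of $X_\theta$ is its unconditional law, with respect to the joint randomness of $X$ and $\theta$. -/

import Mathlib

open MeasureTheory ProbabilityTheory
open scoped ENNReal NNReal

noncomputable section

/-- The Stiefel manifold of orthonormal `k`-frames `(θ₁, …, θₖ)` in `ℝᵈ`, with the topology and
the Borel σ-algebra inherited from `(ℝᵈ)ᵏ`. -/
abbrev Stiefel (d k : ℕ) : Type :=
  {θ : Fin k → EuclideanSpace ℝ (Fin d) // Orthonormal ℝ θ}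

/-- The orthogonal group `O(d)`. -/
abbrev OrthGroup (d : ℕ) : Type := Matrix.orthogonalGroup (Fin d) ℝ

instance instMeasurableSpaceOrthGroup (d : ℕ) : MeasurableSpace (OrthGroup d) :=
  borel _

instance instBorelSpaceOrthGroup (d : ℕ) : BorelSpace (OrthGroup d) := ⟨rfl⟩

theorem isCompact_orthGroup (d : ℕ) :
    IsCompact (Matrix.orthogonalGroup (Fin d) ℝ : Set (Matrix (Fin d) (Fin d) ℝ)) := by
  refine IsCompact.of_isClosed_subset
    (isCompact_univ_pi fun _ : Fin d => isCompact_univ_pi fun _ : Fin d =>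
      isCompact_Icc (a := (-1 : ℝ)) (b := 1)) isClosed_unitary ?_
  intro U hU i _ j _
  have h := entry_norm_bound_of_unitary hU i j
  rw [Real.norm_eq_abs] at h
  exact abs_le.mp h

instance instCompactSpaceOrthGroup (d : ℕ) : CompactSpace (OrthGroup d) :=
  isCompact_iff_compactSpace.mp (isCompact_orthGroup d)

/-- The Haar probability measure on `O(d)`. -/
def orthHaar (d : ℕ) : Measure (OrthGroup d) := Measure.haarMeasure ⊤

/-- The rotation `x ↦ U x` of `ℝᵈ` given by an orthogonal matrix `U`. -/
def orthAct {d : ℕ} (U : OrthGroup d) (x : EuclideanSpace ℝ (Fin d)) :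
    EuclideanSpace ℝ (Fin d) :=
  Matrix.toEuclideanLin (U : Matrix (Fin d) (Fin d) ℝ) x

theorem orthAct_mul {d : ℕ} (U V : OrthGroup d) (x : EuclideanSpace ℝ (Fin d)) :
    orthAct (U * V) x = orthAct U (orthAct V x) := by
  ext i
  simp [orthAct, Matrix.toLpLin_apply, Matrix.mulVec_mulVec]

theorem inner_orthAct {d : ℕ} (U : OrthGroup d) (x y : EuclideanSpace ℝ (Fin d)) :
    inner ℝ (orthAct U x) (orthAct U y) = inner ℝ x y := by
  have hU : (U : Matrix (Fin d) (Fin d) ℝ).conjTranspose *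
      (U : Matrix (Fin d) (Fin d) ℝ) = 1 := (Unitary.mem_iff.mp U.2).1
  rw [Matrix.conjTranspose_eq_transpose_of_trivial] at hU
  simp only [orthAct]
  rw [← LinearMap.adjoint_inner_right, ← Matrix.toEuclideanLin_conjTranspose_eq_adjoint]
  congr 1
  ext i
  simp [Matrix.toLpLin_apply, Matrix.mulVec_mulVec, hU]

theorem continuous_orthAct (d : ℕ) :
    Continuous fun p : OrthGroup d × EuclideanSpace ℝ (Fin d) => orthAct p.1 p.2 := by
  simp only [orthAct, Matrix.toLpLin_apply]
  refine (PiLp.continuous_toLp 2 _).comp ?_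
  refine Continuous.matrix_mulVec (by fun_prop) ?_
  exact (PiLp.continuous_ofLp 2 _).comp continuous_snd

/-- The rotated frame `(U θ₁, …, U θₖ)`. -/
def Stiefel.rotate {d k : ℕ} (U : OrthGroup d) (θ : Stiefel d k) : Stiefel d k :=
  ⟨fun i => orthAct U (θ.1 i), by
    have h := θ.2
    rw [orthonormal_iff_ite] at h ⊢
    intro i j
    rw [inner_orthAct, h i j]⟩

/-- The frame `(e₁, …, eₖ)` of the first `k` standard basis vectors of `ℝᵈ`. -/
def Stiefel.base {d k : ℕ} (hk : k ≤ d) : Stiefel d k :=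
  ⟨fun i => EuclideanSpace.basisFun (Fin d) ℝ (Fin.castLE hk i),
    (EuclideanSpace.basisFun (Fin d) ℝ).orthonormal.comp _ (Fin.castLE_injective hk)⟩

/-- The Haar (rotation-invariant probability) measure on the Stiefel manifold: the law of
`(U e₁, …, U eₖ)`, where `U` is Haar distributed on `O(d)`. -/
def stiefelHaar {d k : ℕ} (hk : k ≤ d) : Measure (Stiefel d k) :=
  (orthHaar d).map fun U => Stiefel.rotate U (Stiefel.base hk)

theorem Stiefel.continuous_rotate (d k : ℕ) :
    Continuous fun p : OrthGroup d × Stiefel d k => Stiefel.rotate p.1 p.2 := by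
  refine Continuous.subtype_mk (continuous_pi fun i => ?_) _
  exact (continuous_orthAct d).comp (continuous_fst.prodMk
    ((continuous_apply i).comp (continuous_subtype_val.comp continuous_snd)))

theorem Stiefel.measurable_rotate_left {d k : ℕ} (θ : Stiefel d k) :
    Measurable fun U : OrthGroup d => Stiefel.rotate U θ :=
  ((Stiefel.continuous_rotate d k).comp (continuous_id.prodMk continuous_const)).measurable

theorem Stiefel.measurable_rotate {d k : ℕ} (U : OrthGroup d) :
    Measurable fun θ : Stiefel d k => Stiefel.rotate U θ :=
  ((Stiefel.continuous_rotate d k).comp (continuous_const.prodMk continuous_id)).measurable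

instance instIsProbabilityMeasureStiefelHaar {d k : ℕ} (hk : k ≤ d) :
    IsProbabilityMeasure (stiefelHaar hk) := by
  have : IsProbabilityMeasure (orthHaar d) :=
    ⟨Measure.haarMeasure_self (K₀ := (⊤ : TopologicalSpace.PositiveCompacts (OrthGroup d)))⟩
  exact Measure.isProbabilityMeasure_map (Stiefel.measurable_rotate_left _).aemeasurable

/-- The measure `stiefelHaar` is rotation invariant. -/
theorem stiefelHaar_map_rotate {d k : ℕ} (hk : k ≤ d) (U : OrthGroup d) :
    (stiefelHaar hk).map (Stiefel.rotate U) = stiefelHaar hk := by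
  have h : (orthHaar d).map (fun V => U * V) = orthHaar d :=
    Measure.isMulLeftInvariant_haarMeasure _ |>.map_mul_left_eq_self U
  unfold stiefelHaar
  rw [Measure.map_map (Stiefel.measurable_rotate U) (Stiefel.measurable_rotate_left _)]
  conv_rhs => rw [← h]
  rw [Measure.map_map (Stiefel.measurable_rotate_left _)
    (show Continuous fun V : OrthGroup d => U * V by fun_prop).measurable]
  congr 1
  funext V
  apply Subtype.ext
  funext i
  exact (orthAct_mul U V _).symm

/-- The projection `(⟨x, θ₁⟩, …, ⟨x, θₖ⟩) ∈ ℝᵏ` of `x ∈ ℝᵈ` onto the span of the frame `θ`. -/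
def stiefelProj {d k : ℕ} (θ : Stiefel d k) (x : EuclideanSpace ℝ (Fin d)) :
    EuclideanSpace ℝ (Fin k) :=
  WithLp.toLp 2 fun i => inner ℝ x (θ.1 i)

/-- The Wasserstein distance `sup |E f(Y) - E f(X)|` over the functions `f` with
`|f x - f y| ≤ |x - y|`, between integrable random vectors `X` on `(Ω, P)` and `Y` on `(Ω', Q)`.
The supremum is taken in `[0, ∞]`, so it is never a default value. -/
def wassersteinDist {Ω Ω' E : Type*} [MeasurableSpace Ω] [MeasurableSpace Ω']
    [NormedAddCommGroup E] (X : Ω → E) (P : Measure Ω) (Y : Ω' → E) (Q : Measure Ω') : ℝ≥0∞ :=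
  ⨆ (f : E → ℝ) (_ : LipschitzWith 1 f),
    ENNReal.ofReal |(∫ ω, f (Y ω) ∂Q) - ∫ ω, f (X ω) ∂P|

end

/-!
# Random projections are close to Gaussian in the Wasserstein distance

Write `W` for the projection of `X` on the random frame, `R = ‖X‖`, and let `Z` be a standard
Gaussian vector independent of `(X, θ)`. For a smooth `1`-Lipschitz function `f`, the expectations
of `f(W)` and `f(σ Z)` are joined by `Ψ(s) = 𝔼 f(Y)`, `Y = cos s W + σ sin s Z`, `0 ≤ s ≤ π / 2`, with

`Ψ'(s) = -sin s 𝔼[Df(Y) W] + σ cos s 𝔼[Df(Y) Z]`.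

Two facts make this small. Since the law of the frame is rotation invariant, the average of
`φ(W)` over frames depends on `X` only through `R`; its second derivatives along great circles
vanish, and summing over the directions orthogonal to `X` gives
`𝔼[R² Δφ(W) - D²φ(W)(W, W) - (d - 1) Dφ(W) W] = 0` (`integral_stiefelProj_laplacian`). On the other
side, Gaussian integration by parts is `𝔼[⟨v, Z⟩ g(Z)] = 𝔼[Dg(Z) v]`
(`integral_inner_mul_stdGaussian`). The first identity turns `Df(Y) W` into second derivatives of
`f`, and the second turns these back into first derivatives, with the result
(`integral_fderiv_trigInterp`)

`(d - 1) Ψ'(s) = (cos s / σ) 𝔼[((d - 1) σ² - R²) Df(Y) Z + ⟨W, Z⟩ Df(Y) W]`.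

As `‖Df‖ ≤ 1`, the expectation is at most `(𝔼|R² - σ² d| + σ²) √k + 𝔼‖W‖²`, and `𝔼‖W‖² = σ² k`.
Since `∫ cos = 1` over `[0, π / 2]`, this is the claimed bound. A Lipschitz function is uniformly
close to smooth ones with the same Lipschitz constant (`LipschitzWith.exists_contDiff_approx`), so
the bound passes to all of them.
-/

/-! ### Gaussian integration by parts -/

/-- One-dimensional integration by parts: `g'(t) - t g(t)` is the derivative of `g` times the Gaussian
density, divided by that density. -/
theorem integral_deriv_sub_mul_gaussianReal {g g' : ℝ → ℝ} {C : ℝ}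
    (hg : ∀ t, HasDerivAt g (g' t) t) (hgC : ∀ t, |g t| ≤ C) (hgC' : ∀ t, |g' t| ≤ C) :
    ∫ t, (g' t - t * g t) ∂gaussianReal 0 1 = 0 := by
  have hg'_eq : g' = deriv g := funext fun t => (hg t).deriv.symm
  have hgm : Measurable g :=
    (continuous_iff_continuousAt.2 fun t => (hg t).continuousAt).measurable
  have hg'm : Measurable g' := hg'_eq ▸ measurable_deriv g
  have hφ (t : ℝ) : HasDerivAt (gaussianPDFReal 0 1) (-t * gaussianPDFReal 0 1 t) t := by
    have h : HasDerivAt (fun t : ℝ => (√(2 * Real.pi * (1 : ℝ≥0)))⁻¹ *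
        Real.exp (-(t - 0) ^ 2 / (2 * (1 : ℝ≥0)))) _ t :=
      ((((hasDerivAt_id t).sub_const 0).pow 2).neg.div_const (2 * ((1 : ℝ≥0) : ℝ))).exp.const_mul _
    convert! h using 1
    simp [gaussianPDFReal_def]
    ring
  have hint {h : ℝ → ℝ} (hh : Integrable h (gaussianReal 0 1)) :
      Integrable (fun t => gaussianPDFReal 0 1 t * h t) := by
    rw [gaussianReal_of_var_ne_zero 0 one_ne_zero, integrable_withDensity_iff_integrable_smul'
      (measurable_gaussianPDF 0 1) (by simp [gaussianPDF])] at hh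
    simpa [toReal_gaussianPDF] using hh
  have hbd {h : ℝ → ℝ} (hm : Measurable h) (hC : ∀ t, |h t| ≤ C) :
      Integrable h (gaussianReal 0 1) :=
    Integrable.of_bound hm.aestronglyMeasurable C (ae_of_all _ hC)
  have hid : Integrable (fun t : ℝ => t) (gaussianReal 0 1) :=
    memLp_one_iff_integrable.1 (memLp_id_gaussianReal' 1 (by simp))
  have h2 : Integrable (fun t => t * g t) (gaussianReal 0 1) :=
    hid.mul_bdd hgm.aestronglyMeasurable (ae_of_all _ hgC)
  rw [integral_gaussianReal_eq_integral_smul one_ne_zero]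
  refine integral_eq_zero_of_hasDerivAt_of_integrable
    (f := fun t => gaussianPDFReal 0 1 t * g t) (fun t => ?_) ?_ (hint (hbd hgm hgC))
  · convert! (hφ t).mul (hg t) using 1
    simp only [smul_eq_mul]
    ring
  · simpa using hint ((hbd hg'm hgC').sub h2)

theorem integrable_inner_mul_stdGaussian {k : ℕ} {g : EuclideanSpace ℝ (Fin k) → ℝ} {C : ℝ}
    (hg : Continuous g) (hgC : ∀ z, |g z| ≤ C) (v : EuclideanSpace ℝ (Fin k)) :
    Integrable (fun z => inner ℝ v z * g z) (stdGaussian (EuclideanSpace ℝ (Fin k))) :=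
  (IsGaussian.integrable_id.const_inner v).mul_bdd hg.aestronglyMeasurable (ae_of_all _ hgC)

theorem integrable_fderiv_stdGaussian {k : ℕ} {g : EuclideanSpace ℝ (Fin k) → ℝ} {C : ℝ}
    (hg : ContDiff ℝ 1 g) (hgC' : ∀ z, ‖fderiv ℝ g z‖ ≤ C) (v : EuclideanSpace ℝ (Fin k)) :
    Integrable (fun z => fderiv ℝ g z v) (stdGaussian (EuclideanSpace ℝ (Fin k))) :=
  Integrable.of_bound
    ((hg.continuous_fderiv one_ne_zero).clm_apply continuous_const).aestronglyMeasurable (C * ‖v‖)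
    (ae_of_all _ fun z => (ContinuousLinearMap.le_opNorm _ _).trans (by gcongr; exact hgC' z))

/-- Fubini reduces integration by parts along a basis vector to the one-dimensional case. -/
theorem integral_inner_basis_mul_stdGaussian {k : ℕ} {g : EuclideanSpace ℝ (Fin k) → ℝ} {C : ℝ}
    (hg : ContDiff ℝ 1 g) (hgC : ∀ z, |g z| ≤ C) (hgC' : ∀ z, ‖fderiv ℝ g z‖ ≤ C) (i : Fin k) :
    ∫ z, (fderiv ℝ g z (EuclideanSpace.single i 1) - inner ℝ (EuclideanSpace.single i 1) z * g z)
      ∂stdGaussian (EuclideanSpace ℝ (Fin k)) = 0 := by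
  have hI := (integrable_fderiv_stdGaussian hg hgC' (EuclideanSpace.single i 1)).sub
    (integrable_inner_mul_stdGaussian hg.continuous hgC (EuclideanSpace.single i 1))
  obtain _ | n := k
  · exact i.elim0
  have hmp := (measurePreserving_piFinSuccAbove (fun _ : Fin (n + 1) => gaussianReal 0 1) i).symm
  have hto : MeasurePreserving (WithLp.toLp 2) (Measure.pi fun _ : Fin (n + 1) => gaussianReal 0 1)
      (stdGaussian (EuclideanSpace ℝ (Fin (n + 1)))) := ⟨by fun_prop, map_pi_eq_stdGaussian⟩
  have hcomp := hto.comp hmp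
  set e : ℝ × (Fin n → ℝ) → EuclideanSpace ℝ (Fin (n + 1)) :=
    WithLp.toLp 2 ∘ (MeasurableEquiv.piFinSuccAbove (fun _ : Fin (n + 1) => ℝ) i).symm
  have hI' := hcomp.integrable_comp_of_integrable hI
  rw [← hcomp.map_eq, integral_map hcomp.aemeasurable (hcomp.map_eq ▸ hI.aestronglyMeasurable)]
  refine (integral_prod_symm _ hI').trans ?_
  refine integral_eq_zero_of_ae (ae_of_all _ fun y => ?_)
  simp only [Pi.zero_apply]
  have he' (t : ℝ) (j : Fin (n + 1)) : e (t, y) j = Fin.insertNth (α := fun _ => ℝ) i t y j := rfl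
  have hline (t : ℝ) : e (t, y) = e (0, y) + t • EuclideanSpace.single i (1 : ℝ) := by
    ext j
    rw [PiLp.add_apply, PiLp.smul_apply, he', he']
    rcases eq_or_ne j i with rfl | hj
    · rw [Fin.insertNth_apply_same, Fin.insertNth_apply_same]
      simp
    · obtain ⟨l, rfl⟩ := Fin.exists_succAbove_eq hj
      rw [Fin.insertNth_apply_succAbove, Fin.insertNth_apply_succAbove]
      rw [PiLp.single_apply, if_neg hj, smul_zero, add_zero]
  have hd (t : ℝ) : HasDerivAt (fun t => e (t, y)) (EuclideanSpace.single i (1 : ℝ)) t := by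
    rw [funext hline]
    have h := ((hasDerivAt_id t).smul_const (EuclideanSpace.single i (1 : ℝ))).const_add (e (0, y))
    rwa [one_smul] at h
  have hcoord (t : ℝ) : inner ℝ (EuclideanSpace.single i (1 : ℝ)) (e (t, y)) = t := by
    rw [EuclideanSpace.inner_single_left, he', Fin.insertNth_apply_same]
    simp
  simp only [Function.comp_apply, Pi.sub_apply, hcoord]
  refine integral_deriv_sub_mul_gaussianReal (C := C) (g := fun t => g (e (t, y))) (fun t =>
    (hg.differentiable one_ne_zero _).hasFDerivAt.comp_hasDerivAt t (hd t)) (fun t => hgC _)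
    fun t => ?_
  refine ((fderiv ℝ g (e (t, y))).le_opNorm (EuclideanSpace.single i 1)).trans ?_
  simpa using hgC' _

/-- Integration by parts against the standard Gaussian measure (Stein's identity). -/
theorem integral_inner_mul_stdGaussian {k : ℕ} {g : EuclideanSpace ℝ (Fin k) → ℝ} {C : ℝ}
    (hg : ContDiff ℝ 1 g) (hgC : ∀ z, |g z| ≤ C) (hgC' : ∀ z, ‖fderiv ℝ g z‖ ≤ C)
    (v : EuclideanSpace ℝ (Fin k)) :
    ∫ z, inner ℝ v z * g z ∂stdGaussian (EuclideanSpace ℝ (Fin k)) =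
      ∫ z, fderiv ℝ g z v ∂stdGaussian (EuclideanSpace ℝ (Fin k)) := by
  have hv : v = ∑ i, v i • EuclideanSpace.single i (1 : ℝ) := by
    simpa using ((EuclideanSpace.basisFun (Fin k) ℝ).sum_repr v).symm
  have h (i : Fin k) := integral_inner_basis_mul_stdGaussian hg hgC hgC' i
  have hi (i : Fin k) := integrable_inner_mul_stdGaussian hg.continuous hgC
    (EuclideanSpace.single i 1)
  have hi' (i : Fin k) := integrable_fderiv_stdGaussian hg hgC' (EuclideanSpace.single i 1)
  simp only [integral_sub (hi' _) (hi _), sub_eq_zero] at h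
  rw [hv]
  simp only [sum_inner, inner_smul_left, map_sum, map_smul, Finset.sum_mul, smul_eq_mul, mul_assoc]
  rw [integral_finsetSum _ fun i _ => (hi i).const_mul _,
    integral_finsetSum _ fun i _ => (hi' i).const_mul _]
  simp only [integral_const_mul, h, conj_trivial]

theorem integral_inner_sq_stdGaussian {k : ℕ} (v : EuclideanSpace ℝ (Fin k)) :
    ∫ z, inner ℝ v z ^ 2 ∂stdGaussian (EuclideanSpace ℝ (Fin k)) = ‖v‖ ^ 2 := by
  have h := variance_dual_stdGaussian (innerSL ℝ v)
  rw [variance_of_integral_eq_zero (innerSL ℝ v).continuous.aemeasurable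
    (integral_strongDual_stdGaussian _)] at h
  simpa using h

theorem integral_norm_sq_stdGaussian (k : ℕ) :
    ∫ z, ‖z‖ ^ 2 ∂stdGaussian (EuclideanSpace ℝ (Fin k)) = k := by
  simp only [← (EuclideanSpace.basisFun (Fin k) ℝ).sum_sq_inner_right]
  rw [integral_finsetSum]
  · simp [integral_inner_sq_stdGaussian, -EuclideanSpace.basisFun_apply, -EuclideanSpace.basisFun_inner]
  · intro i _
    exact ((IsGaussian.memLp_two_id (μ := stdGaussian (EuclideanSpace ℝ (Fin k)))).const_inner
      _).integrable_sq

/-- Jensen's inequality for the square. -/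
theorem integral_le_of_integral_sq_le {Ω : Type*} [MeasurableSpace Ω] {μ : Measure Ω}
    [IsProbabilityMeasure μ] {f : Ω → ℝ} {b : ℝ} (hf : MemLp f 2 μ) (hb : 0 ≤ b)
    (h : ∫ x, f x ^ 2 ∂μ ≤ b ^ 2) : ∫ x, f x ∂μ ≤ b := by
  have hv := variance_nonneg f μ
  rw [variance_eq_sub hf] at hv
  simp only [Pi.pow_apply] at hv
  exact le_of_sq_le_sq (by linarith) hb

/-! ### Smoothing of Lipschitz functions -/

section Smoothing

open Convolution ContinuousLinearMap

variable {E : Type*} [NormedAddCommGroup E] [InnerProductSpace ℝ E] [FiniteDimensional ℝ E]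
  [MeasurableSpace E] [BorelSpace E]

/-- If `f` is `1`-Lipschitz, so is its average `ρ ⋆ f` against a probability density, and the
derivative `(Dρ) ⋆ f` is Lipschitz with the constant `‖Dρ‖₁`. -/
theorem LipschitzWith.exists_contDiff_approx {f : E → ℝ} (hf : LipschitzWith 1 f) {ε : ℝ}
    (hε : 0 < ε) : ∃ (g : E → ℝ) (C : ℝ), ContDiff ℝ 2 g ∧ (∀ x, |g x - f x| ≤ ε) ∧
      (∀ x, ‖fderiv ℝ g x‖ ≤ 1) ∧ ∀ x, ‖fderiv ℝ (fderiv ℝ g) x‖ ≤ C := by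
  let φ : ContDiffBump (0 : E) := ⟨ε / 2, ε, by positivity, by linarith⟩
  let μ : Measure E := volume
  set ρ : E → ℝ := φ.normed μ
  have hρc : HasCompactSupport ρ := φ.hasCompactSupport_normed
  have hρs : ContDiff ℝ 2 ρ := φ.contDiff_normed
  have hfl : LocallyIntegrable f μ := hf.continuous.locallyIntegrable
  set g : E → ℝ := ρ ⋆[lsmul ℝ ℝ, μ] f
  have hDρ : Continuous (fderiv ℝ ρ) := hρs.continuous_fderiv two_ne_zero
  have hDint : Integrable (fderiv ℝ ρ) μ :=
    hDρ.integrable_of_hasCompactSupport (hρc.fderiv ℝ)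
  have hdist (x y t : E) : |f (x - t) - f (y - t)| ≤ ‖x - y‖ := by
    simpa [Real.dist_eq, dist_eq_norm] using hf.dist_le_mul (x - t) (y - t)
  have hder (x : E) : HasFDerivAt g
      ((fderiv ℝ ρ ⋆[(lsmul ℝ ℝ).precompL E, μ] f) x) x :=
    hρc.hasFDerivAt_convolution_left (lsmul ℝ ℝ) (hρs.of_le one_le_two) hfl x
  have hfd : fderiv ℝ g = (fderiv ℝ ρ ⋆[(lsmul ℝ ℝ).precompL E, μ] f) :=
    funext fun x => (hder x).fderiv
  refine ⟨g, ∫ t, ‖fderiv ℝ ρ t‖ ∂μ, hρc.contDiff_convolution_left (n := 2) _ hρs hfl,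
    fun x => ?_, fun x => ?_, fun x => ?_⟩
  · refine φ.dist_normed_convolution_le hf.continuous.aestronglyMeasurable fun y hy => ?_
    refine (hf.dist_le_mul y x).trans ?_
    simpa using (Metric.mem_ball.1 hy).le
  · refine norm_fderiv_le_of_lip' ℝ zero_le_one (Filter.Eventually.of_forall fun y => ?_)
    have hex (y : E) : Integrable (fun t => ρ t • f (y - t)) μ :=
      (hρc.convolutionExists_left (lsmul ℝ ℝ) hρs.continuous hfl y)
    have hsub : g y - g x = ∫ t, ρ t * (f (y - t) - f (x - t)) ∂μ := by
      simp only [mul_sub]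
      exact (integral_sub (hex y) (hex x)).symm
    rw [hsub, one_mul]
    calc _ ≤ ∫ t, ρ t * ‖y - x‖ ∂μ :=
          norm_integral_le_of_norm_le (φ.integrable_normed.mul_const _) (ae_of_all _ fun t => by
            rw [norm_mul, Real.norm_of_nonneg (φ.nonneg_normed t)]
            exact mul_le_mul_of_nonneg_left (hdist y x t) (φ.nonneg_normed t))
      _ = ‖y - x‖ := by rw [integral_mul_const, φ.integral_normed, one_mul]
  · refine norm_fderiv_le_of_lip' ℝ (integral_nonneg fun _ => norm_nonneg _)
      (Filter.Eventually.of_forall fun y => ?_)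
    have hex (y : E) : Integrable (fun t => (lsmul ℝ ℝ).precompL E (fderiv ℝ ρ t) (f (y - t))) μ :=
      (hρc.fderiv ℝ).convolutionExists_left _ hDρ hfl y
    have hsub : fderiv ℝ g y - fderiv ℝ g x =
        ∫ t, (lsmul ℝ ℝ).precompL E (fderiv ℝ ρ t) (f (y - t) - f (x - t)) ∂μ := by
      simp only [map_sub, hfd]
      exact (integral_sub (hex y) (hex x)).symm
    rw [hsub, ← integral_mul_const]
    refine norm_integral_le_of_norm_le (hDint.norm.mul_const _) (ae_of_all _ fun t => ?_)
    have heq : (lsmul ℝ ℝ).precompL E (fderiv ℝ ρ t) (f (y - t) - f (x - t)) =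
        (f (y - t) - f (x - t)) • fderiv ℝ ρ t := by
      ext v
      simp [precompL_apply]
      ring
    rw [heq, norm_smul, mul_comm]
    exact mul_le_mul_of_nonneg_left (hdist y x t) (norm_nonneg _)

end Smoothing

/-! ### Projections on random frames -/

theorem continuous_stiefelProj (d k : ℕ) :
    Continuous fun p : Stiefel d k × EuclideanSpace ℝ (Fin d) => stiefelProj p.1 p.2 := by
  refine (PiLp.continuous_toLp 2 _).comp (continuous_pi fun i => ?_)
  exact continuous_snd.inner ((continuous_apply i).comp (continuous_subtype_val.comp continuous_fst))

theorem continuous_stiefelProj_left {d k : ℕ} (x : EuclideanSpace ℝ (Fin d)) :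
    Continuous fun θ : Stiefel d k => stiefelProj θ x :=
  (continuous_stiefelProj d k).comp (continuous_id.prodMk continuous_const)

theorem stiefelProj_add {d k : ℕ} (θ : Stiefel d k) (x y : EuclideanSpace ℝ (Fin d)) :
    stiefelProj θ (x + y) = stiefelProj θ x + stiefelProj θ y := by
  ext i
  simp [stiefelProj, inner_add_left]

theorem stiefelProj_smul {d k : ℕ} (θ : Stiefel d k) (c : ℝ) (x : EuclideanSpace ℝ (Fin d)) :
    stiefelProj θ (c • x) = c • stiefelProj θ x := by
  ext i
  simp [stiefelProj, inner_smul_left]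

theorem norm_stiefelProj_le {d k : ℕ} (θ : Stiefel d k) (x : EuclideanSpace ℝ (Fin d)) :
    ‖stiefelProj θ x‖ ≤ ‖x‖ := by
  refine le_of_sq_le_sq ?_ (norm_nonneg x)
  rw [EuclideanSpace.norm_sq_eq]
  have h := θ.2.sum_inner_products_le (s := Finset.univ) x
  simpa [stiefelProj, real_inner_comm] using h

theorem stiefelProj_rotate {d k : ℕ} (U : OrthGroup d) (θ : Stiefel d k)
    (x : EuclideanSpace ℝ (Fin d)) :
    stiefelProj (Stiefel.rotate U θ) (orthAct U x) = stiefelProj θ x := by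
  ext i
  simp [stiefelProj, Stiefel.rotate, inner_orthAct]

/-- The orthogonal group acts transitively on spheres: the reflection in the hyperplane orthogonal
to `x - y` maps `x` to `y`. -/
theorem exists_orthAct_eq {d : ℕ} {x y : EuclideanSpace ℝ (Fin d)} (h : ‖x‖ = ‖y‖) :
    ∃ U : OrthGroup d, orthAct U x = y := by
  have hr := Submodule.reflection_sub h
  set r := (ℝ ∙ (x - y))ᗮ.reflection
  let b := EuclideanSpace.basisFun (Fin d) ℝ
  refine ⟨⟨b.toBasis.toMatrix (b.map r), b.toMatrix_orthonormalBasis_mem_orthogonal _⟩, ?_⟩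
  rw [← hr]
  have hx : x = ∑ j, x j • EuclideanSpace.single j (1 : ℝ) := by
    simpa [b] using (b.sum_repr x).symm
  clear_value r
  ext i
  conv_rhs => rw [hx]
  simp [orthAct, Matrix.toLpLin_apply, Matrix.mulVec, dotProduct, Module.Basis.toMatrix_apply, b,
    mul_comm]

/-- By rotation invariance of the frame, the law of the projection of `x` depends on `‖x‖` only. -/
theorem integral_stiefelProj_congr_norm {d k : ℕ} (hk : k ≤ d) {F : EuclideanSpace ℝ (Fin k) → ℝ}
    (hF : Continuous F) {x y : EuclideanSpace ℝ (Fin d)} (h : ‖x‖ = ‖y‖) :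
    ∫ θ, F (stiefelProj θ x) ∂stiefelHaar hk = ∫ θ, F (stiefelProj θ y) ∂stiefelHaar hk := by
  obtain ⟨U, rfl⟩ := exists_orthAct_eq h
  conv_rhs => rw [← stiefelHaar_map_rotate hk U]
  have hm : AEStronglyMeasurable (fun θ => F (stiefelProj θ (orthAct U x)))
      ((stiefelHaar hk).map (Stiefel.rotate U)) :=
    (hF.comp (continuous_stiefelProj_left _)).aestronglyMeasurable
  rw [integral_map (Stiefel.measurable_rotate U).aemeasurable hm]
  simp only [stiefelProj_rotate]

theorem stiefelProj_eq_sum {d k : ℕ} (θ : Stiefel d k) (x : EuclideanSpace ℝ (Fin d)) :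
    stiefelProj θ x = ∑ a, inner ℝ x (θ.1 a) • EuclideanSpace.single a (1 : ℝ) := by
  simpa [stiefelProj] using ((EuclideanSpace.basisFun (Fin k) ℝ).sum_repr (stiefelProj θ x)).symm

/-- The projection on an orthonormal frame is a coisometry, so pulling a bilinear form back along it
preserves the trace. -/
theorem sum_bilin_stiefelProj {d k : ℕ} {ι : Type*} [Fintype ι] (θ : Stiefel d k)
    (b : OrthonormalBasis ι ℝ (EuclideanSpace ℝ (Fin d)))
    (B : EuclideanSpace ℝ (Fin k) →L[ℝ] EuclideanSpace ℝ (Fin k) →L[ℝ] ℝ) :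
    ∑ i, B (stiefelProj θ (b i)) (stiefelProj θ (b i)) =
      ∑ a, B (EuclideanSpace.single a 1) (EuclideanSpace.single a 1) := by
  simp only [stiefelProj_eq_sum, map_sum, map_smul, sum_apply,
    smul_apply, smul_eq_mul]
  rw [Finset.sum_comm]
  refine Finset.sum_congr rfl fun a _ => ?_
  simp only [Finset.mul_sum]
  rw [Finset.sum_comm]
  have horth := orthonormal_iff_ite.1 θ.2
  have h (c : Fin k) : ∑ i, inner ℝ (b i) (θ.1 a) * (inner ℝ (b i) (θ.1 c) *
      B (EuclideanSpace.single c 1) (EuclideanSpace.single a 1)) =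
      (if a = c then 1 else 0) * B (EuclideanSpace.single c 1) (EuclideanSpace.single a 1) := by
    rw [← horth, ← b.sum_inner_mul_inner, Finset.sum_mul]
    refine Finset.sum_congr rfl fun i _ => ?_
    rw [real_inner_comm (b i) (θ.1 a)]
    ring
  rw [Finset.sum_congr rfl fun c _ => h c]
  simp

theorem abs_le_of_norm_fderiv_le {E : Type*} [NormedAddCommGroup E] [NormedSpace ℝ E]
    {φ : E → ℝ} {C : ℝ} (hφ : Differentiable ℝ φ) (hC : ∀ w, ‖fderiv ℝ φ w‖ ≤ C) (w : E) :
    |φ w| ≤ |φ 0| + C * ‖w‖ := by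
  have h := Convex.norm_image_sub_le_of_norm_fderiv_le (𝕜 := ℝ) (fun y _ => hφ y)
    (fun y _ => hC y) convex_univ (Set.mem_univ 0) (Set.mem_univ w)
  rw [sub_zero, Real.norm_eq_abs] at h
  linarith [abs_sub_abs_le_abs_sub (φ w) (φ 0)]

/-- For `e ⟂ x` with `‖e‖ = ‖x‖`, the average of `φ` over the projections of `cos α x + sin α e` does
not depend on `α`; this is its second derivative at `α = 0`. -/
theorem integral_stiefelProj_second_variation {d k : ℕ} (hk : k ≤ d)
    {φ : EuclideanSpace ℝ (Fin k) → ℝ} {C : ℝ} (hφ : ContDiff ℝ 2 φ)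
    (hC : ∀ w, ‖fderiv ℝ φ w‖ ≤ C) (hC' : ∀ w, ‖fderiv ℝ (fderiv ℝ φ) w‖ ≤ C)
    {x e : EuclideanSpace ℝ (Fin d)} (hxe : inner ℝ x e = 0) (hn : ‖e‖ = ‖x‖) :
    Integrable (fun θ => fderiv ℝ (fderiv ℝ φ) (stiefelProj θ x) (stiefelProj θ e)
      (stiefelProj θ e) - fderiv ℝ φ (stiefelProj θ x) (stiefelProj θ x)) (stiefelHaar hk) ∧
    ∫ θ, (fderiv ℝ (fderiv ℝ φ) (stiefelProj θ x) (stiefelProj θ e) (stiefelProj θ e)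
      - fderiv ℝ φ (stiefelProj θ x) (stiefelProj θ x)) ∂stiefelHaar hk = 0 := by
  have hC0 : 0 ≤ C := (norm_nonneg _).trans (hC 0)
  have hd1 : Differentiable ℝ φ := hφ.differentiable two_ne_zero
  have hφ' : ContDiff ℝ 1 (fderiv ℝ φ) := hφ.fderiv_right (by norm_num)
  have hd2 : Differentiable ℝ (fderiv ℝ φ) := hφ'.differentiable one_ne_zero
  set c : ℝ → EuclideanSpace ℝ (Fin d) := fun α => Real.cos α • x + Real.sin α • e with hc
  set c' : ℝ → EuclideanSpace ℝ (Fin d) := fun α => -Real.sin α • x + Real.cos α • e with hc'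
  have hcn (α : ℝ) : ‖c α‖ = ‖x‖ := by
    refine (sq_eq_sq₀ (norm_nonneg _) (norm_nonneg _)).1 ?_
    rw [hc, norm_add_sq_real, inner_smul_left, inner_smul_right, hxe, norm_smul, norm_smul, hn,
      mul_pow, mul_pow, Real.norm_eq_abs, Real.norm_eq_abs, sq_abs, sq_abs]
    linear_combination ‖x‖ ^ 2 * Real.sin_sq_add_cos_sq α
  have hcn' (α : ℝ) : ‖c' α‖ = ‖x‖ := by
    refine (sq_eq_sq₀ (norm_nonneg _) (norm_nonneg _)).1 ?_
    rw [hc', norm_add_sq_real, inner_smul_left, inner_smul_right, hxe, norm_smul, norm_smul, hn,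
      mul_pow, mul_pow, Real.norm_eq_abs, Real.norm_eq_abs, sq_abs, sq_abs]
    linear_combination ‖x‖ ^ 2 * Real.sin_sq_add_cos_sq α
  have hw (θ : Stiefel d k) (α : ℝ) :
      HasDerivAt (fun α => stiefelProj θ (c α)) (stiefelProj θ (c' α)) α := by
    simp only [hc, hc', stiefelProj_add, stiefelProj_smul]
    exact ((Real.hasDerivAt_cos α).smul_const _).add ((Real.hasDerivAt_sin α).smul_const _)
  have hw' (θ : Stiefel d k) (α : ℝ) :
      HasDerivAt (fun α => stiefelProj θ (c' α)) (-stiefelProj θ (c α)) α := by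
    simp only [hc, hc', stiefelProj_add, stiefelProj_smul, neg_add, ← neg_smul]
    exact ((Real.hasDerivAt_sin α).neg.smul_const _).add ((Real.hasDerivAt_cos α).smul_const _)
  have hWx (θ : Stiefel d k) (α : ℝ) : ‖stiefelProj θ (c α)‖ ≤ ‖x‖ :=
    (norm_stiefelProj_le _ _).trans_eq (hcn α)
  have hWx' (θ : Stiefel d k) (α : ℝ) : ‖stiefelProj θ (c' α)‖ ≤ ‖x‖ :=
    (norm_stiefelProj_le _ _).trans_eq (hcn' α)
  have hcont (α : ℝ) := continuous_stiefelProj_left (k := k) (c α)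
  have hcont' (α : ℝ) := continuous_stiefelProj_left (k := k) (c' α)
  have hF1m (α : ℝ) : Continuous fun θ : Stiefel d k =>
      fderiv ℝ φ (stiefelProj θ (c α)) (stiefelProj θ (c' α)) :=
    (hφ'.continuous.comp (hcont α)).clm_apply (hcont' α)
  have hF1b (α : ℝ) (θ : Stiefel d k) :
      ‖fderiv ℝ φ (stiefelProj θ (c α)) (stiefelProj θ (c' α))‖ ≤ C * ‖x‖ :=
    (ContinuousLinearMap.le_opNorm _ _).trans
      (mul_le_mul (hC _) (hWx' θ α) (norm_nonneg _) hC0)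
  -- The first derivative vanishes for every `α`, since the average is constant.
  have hfirst (α : ℝ) : ∫ θ, fderiv ℝ φ (stiefelProj θ (c α)) (stiefelProj θ (c' α))
      ∂stiefelHaar hk = 0 := by
    have h := (hasDerivAt_integral_of_dominated_loc_of_deriv_le (μ := stiefelHaar hk)
      (F := fun α θ => φ (stiefelProj θ (c α)))
      (F' := fun α θ => fderiv ℝ φ (stiefelProj θ (c α)) (stiefelProj θ (c' α)))
      (bound := fun _ => C * ‖x‖) (x₀ := α) Filter.univ_mem
      (Filter.Eventually.of_forall fun α =>
        (hφ.continuous.comp (hcont α)).aestronglyMeasurable)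
      (Integrable.of_bound (hφ.continuous.comp (hcont α)).aestronglyMeasurable
        (|φ 0| + C * ‖x‖) (ae_of_all _ fun θ => (abs_le_of_norm_fderiv_le hd1 hC _).trans
          (by gcongr; exact hWx θ α)))
      (hF1m α).aestronglyMeasurable (ae_of_all _ fun θ α _ => hF1b α θ) (integrable_const _)
      (ae_of_all _ fun θ α _ => (hd1 _).hasFDerivAt.comp_hasDerivAt α (hw θ α))).2
    have hconst : (fun α => ∫ θ, φ (stiefelProj θ (c α)) ∂stiefelHaar hk) =
        fun _ => ∫ θ, φ (stiefelProj θ x) ∂stiefelHaar hk :=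
      funext fun α => integral_stiefelProj_congr_norm hk hφ.continuous (hcn α)
    rw [hconst] at h
    exact h.unique (hasDerivAt_const _ _)
  have hsecond := hasDerivAt_integral_of_dominated_loc_of_deriv_le (μ := stiefelHaar hk)
      (F := fun α θ => fderiv ℝ φ (stiefelProj θ (c α)) (stiefelProj θ (c' α)))
      (F' := fun α θ => fderiv ℝ (fderiv ℝ φ) (stiefelProj θ (c α)) (stiefelProj θ (c' α))
        (stiefelProj θ (c' α)) + fderiv ℝ φ (stiefelProj θ (c α)) (-stiefelProj θ (c α)))
      (bound := fun _ => C * ‖x‖ * ‖x‖ + C * ‖x‖) (x₀ := 0) Filter.univ_mem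
      (Filter.Eventually.of_forall fun α => (hF1m α).aestronglyMeasurable)
      (Integrable.of_bound (hF1m 0).aestronglyMeasurable (C * ‖x‖) (ae_of_all _ (hF1b 0)))
      ((((hφ'.continuous_fderiv one_ne_zero).comp (hcont 0)).clm_apply (hcont' 0)).clm_apply
        (hcont' 0) |>.add ((hφ'.continuous.comp (hcont 0)).clm_apply
          (hcont 0).neg)).aestronglyMeasurable
      (ae_of_all _ fun θ α _ => (norm_add_le _ _).trans (add_le_add
        ((ContinuousLinearMap.le_opNorm₂ _ _ _).trans (by
          gcongr
          exacts [hC' _, hWx' θ α, hWx' θ α]))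
        ((ContinuousLinearMap.le_opNorm _ _).trans (by
          rw [norm_neg]
          gcongr
          exacts [hC _, hWx θ α])))) (integrable_const _)
      (ae_of_all _ fun θ α _ => ((hd2 _).hasFDerivAt.comp_hasDerivAt α (hw θ α)).clm_apply
        (hw' θ α))
  have hz : c 0 = x := by simp [hc]
  have hz' : c' 0 = e := by simp [hc']
  simp only [hz, hz', map_neg, ← sub_eq_add_neg] at hsecond
  refine ⟨hsecond.1, ?_⟩
  have h := hsecond.2
  rw [funext hfirst] at h
  exact h.unique (hasDerivAt_const _ _)

/-- The spherical Laplacian has mean zero: if `W` is the projection of `x` on a random frame, then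
`‖x‖² tr D²φ(W) - D²φ(W)(W, W) - (d - 1) Dφ(W) W` integrates to `0`. -/
theorem integral_stiefelProj_laplacian {d k : ℕ} (hk : k ≤ d)
    {φ : EuclideanSpace ℝ (Fin k) → ℝ} {C : ℝ} (hφ : ContDiff ℝ 2 φ)
    (hC : ∀ w, ‖fderiv ℝ φ w‖ ≤ C) (hC' : ∀ w, ‖fderiv ℝ (fderiv ℝ φ) w‖ ≤ C)
    (x : EuclideanSpace ℝ (Fin d)) :
    ∫ θ, (‖x‖ ^ 2 * ∑ a, fderiv ℝ (fderiv ℝ φ) (stiefelProj θ x) (EuclideanSpace.single a 1)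
        (EuclideanSpace.single a 1)
      - fderiv ℝ (fderiv ℝ φ) (stiefelProj θ x) (stiefelProj θ x) (stiefelProj θ x)
      - ((d : ℝ) - 1) * fderiv ℝ φ (stiefelProj θ x) (stiefelProj θ x)) ∂stiefelHaar hk = 0 := by
  rcases eq_or_ne x 0 with rfl | hx
  · have h0 (θ : Stiefel d k) : stiefelProj θ 0 = 0 := by
      simpa using stiefelProj_smul θ 0 0
    simp [h0]
  have hx' : ‖x‖ ≠ 0 := norm_ne_zero_iff.2 hx
  obtain _ | n := d
  · exact absurd (Subsingleton.elim x 0) hx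
  -- An orthonormal basis whose first vector is `x / ‖x‖`; the others are the directions of variation.
  obtain ⟨b, hb⟩ := Orthonormal.exists_orthonormalBasis_extension_of_card_eq (𝕜 := ℝ)
    (E := EuclideanSpace ℝ (Fin (n + 1))) (ι := Fin (n + 1)) (by simp)
    (v := fun _ => ‖x‖⁻¹ • x) (s := {0}) (by
      refine ⟨fun i => by simp [Set.domRestrict, norm_smul, hx'], fun i j hij => ?_⟩
      exact absurd (Subsingleton.elim i j) hij)
  have hb0 : x = ‖x‖ • b 0 := by rw [hb 0 rfl, smul_inv_smul₀ hx']
  have hvar (i : Fin n) := integral_stiefelProj_second_variation hk hφ hC hC' (x := x)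
    (e := ‖x‖ • b i.succ) (by
      conv_lhs => rw [hb0]
      rw [inner_smul_left, inner_smul_right, b.inner_eq_zero (Fin.succ_ne_zero i).symm]
      simp) (by simp [norm_smul])
  have hsum := integral_finsetSum (μ := stiefelHaar hk) Finset.univ fun i _ => (hvar i).1
  rw [Finset.sum_congr rfl fun i _ => (hvar i).2, Finset.sum_const_zero] at hsum
  rw [← hsum]
  refine integral_congr_ae (ae_of_all _ fun θ => ?_)
  have htr := sum_bilin_stiefelProj θ b (fderiv ℝ (fderiv ℝ φ) (stiefelProj θ x))
  rw [Fin.sum_univ_succ] at htr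
  have h0 : fderiv ℝ (fderiv ℝ φ) (stiefelProj θ x) (stiefelProj θ x) (stiefelProj θ x) =
      ‖x‖ ^ 2 * fderiv ℝ (fderiv ℝ φ) (stiefelProj θ x) (stiefelProj θ (b 0))
        (stiefelProj θ (b 0)) := by
    have hT : stiefelProj θ x = ‖x‖ • stiefelProj θ (b 0) := by
      rw [← stiefelProj_smul, ← hb0]
    generalize fderiv ℝ (fderiv ℝ φ) (stiefelProj θ x) = B
    rw [hT]
    simp only [map_smul, smul_apply, smul_eq_mul]
    ring
  simp only [h0, ← htr, stiefelProj_smul, map_smul, smul_apply, smul_eq_mul,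
    Finset.sum_sub_distrib, Finset.sum_const, Finset.card_univ, Fintype.card_fin, nsmul_eq_mul,
    ← Finset.mul_sum]
  push_cast
  ring

/-- By rotation invariance `x` may be replaced by any `‖x‖ • eᵢ`; averaging over `i` gives the trace. -/
theorem integral_norm_sq_stiefelProj {d k : ℕ} (hk : k ≤ d) (x : EuclideanSpace ℝ (Fin d)) :
    d * ∫ θ, ‖stiefelProj θ x‖ ^ 2 ∂stiefelHaar hk = k * ‖x‖ ^ 2 := by
  have hint (y : EuclideanSpace ℝ (Fin d)) :
      Integrable (fun θ => ‖stiefelProj θ y‖ ^ 2) (stiefelHaar hk) :=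
    Integrable.of_bound ((continuous_stiefelProj_left y).norm.pow 2).aestronglyMeasurable (‖y‖ ^ 2)
      (ae_of_all _ fun θ => by
        rw [Real.norm_of_nonneg (by positivity)]
        gcongr
        exact norm_stiefelProj_le θ y)
  have hi (i : Fin d) : ∫ θ, ‖stiefelProj θ x‖ ^ 2 ∂stiefelHaar hk =
      ∫ θ, ‖stiefelProj θ (‖x‖ • EuclideanSpace.basisFun (Fin d) ℝ i)‖ ^ 2 ∂stiefelHaar hk :=
    integral_stiefelProj_congr_norm hk (F := fun w => ‖w‖ ^ 2) (by fun_prop) (by simp [norm_smul])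
  have hsum : ∑ _i : Fin d, ∫ θ, ‖stiefelProj θ x‖ ^ 2 ∂stiefelHaar hk =
      d * ∫ θ, ‖stiefelProj θ x‖ ^ 2 ∂stiefelHaar hk := by simp
  rw [← hsum, Finset.sum_congr rfl fun i _ => hi i, ← integral_finsetSum _ fun i _ => hint _]
  have hpt (θ : Stiefel d k) :
      ∑ i, ‖stiefelProj θ (‖x‖ • EuclideanSpace.basisFun (Fin d) ℝ i)‖ ^ 2 = k * ‖x‖ ^ 2 := by
    have h := sum_bilin_stiefelProj θ (EuclideanSpace.basisFun (Fin d) ℝ) (innerSL ℝ)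
    simp only [innerSL_apply_apply ℝ, real_inner_self_eq_norm_sq] at h
    simp only [stiefelProj_smul, norm_smul, mul_pow, ← Finset.mul_sum, h]
    simp [mul_comm]
  simp [hpt, -EuclideanSpace.basisFun_apply]

/-! ### Derivatives along affine maps -/

theorem ContDiff.hasFDerivAt_comp_smul_add {E F : Type*} [NormedAddCommGroup E] [NormedSpace ℝ E]
    [NormedAddCommGroup F] [NormedSpace ℝ F] {h : E → F} (hh : ContDiff ℝ 1 h) (c : ℝ) (u w : E) :
    HasFDerivAt (fun w => h (c • w + u)) (c • fderiv ℝ h (c • w + u)) w := by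
  have hl : HasFDerivAt (fun w : E => c • w + u) (c • ContinuousLinearMap.id ℝ E) w :=
    ((hasFDerivAt_id w).const_smul c).add_const u
  convert! (hh.differentiable one_ne_zero _).hasFDerivAt.comp w hl using 1
  ext v
  simp

theorem ContDiff.fderiv_comp_smul_add {E F : Type*} [NormedAddCommGroup E] [NormedSpace ℝ E]
    [NormedAddCommGroup F] [NormedSpace ℝ F] {h : E → F} (hh : ContDiff ℝ 1 h) (c : ℝ) (u : E) :
    fderiv ℝ (fun w => h (c • w + u)) = fun w => c • fderiv ℝ h (c • w + u) :=
  funext fun w => (hh.hasFDerivAt_comp_smul_add c u w).fderiv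

section SecondOrder

variable {E : Type*} [NormedAddCommGroup E] [NormedSpace ℝ E] {f : E → ℝ} {C : ℝ}

theorem abs_fderiv_apply_le (hf1 : ∀ w, ‖fderiv ℝ f w‖ ≤ 1) (w v : E) : |fderiv ℝ f w v| ≤ ‖v‖ :=
  ((fderiv ℝ f w).le_opNorm v).trans (mul_le_of_le_one_left (norm_nonneg _) (hf1 _))

theorem abs_fderiv_fderiv_apply_le (hf2 : ∀ w, ‖fderiv ℝ (fderiv ℝ f) w‖ ≤ C) (w v : E) :
    |fderiv ℝ (fderiv ℝ f) w v v| ≤ C * ‖v‖ ^ 2 := by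
  refine ((fderiv ℝ (fderiv ℝ f) w).le_opNorm₂ v v).trans ?_
  rw [mul_assoc, ← sq]
  gcongr
  exact hf2 w

theorem ContDiff.fderiv_fderiv_comp_smul_add (hf : ContDiff ℝ 2 f) (c : ℝ) (u : E) :
    fderiv ℝ (fderiv ℝ fun w => f (c • w + u)) =
      fun w => c • c • fderiv ℝ (fderiv ℝ f) (c • w + u) := by
  have hf' : ContDiff ℝ 1 (fderiv ℝ f) := hf.fderiv_right (by norm_num)
  rw [(hf.of_le one_le_two).fderiv_comp_smul_add]
  exact funext fun w => ((hf'.hasFDerivAt_comp_smul_add c u w).const_smul c).fderiv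

theorem norm_fderiv_comp_smul_add_le (hf : ContDiff ℝ 2 f) (hf1 : ∀ w, ‖fderiv ℝ f w‖ ≤ 1) {c : ℝ}
    (hc : |c| ≤ 1) (u w : E) : ‖fderiv ℝ (fun w => f (c • w + u)) w‖ ≤ 1 := by
  rw [(hf.of_le one_le_two).fderiv_comp_smul_add, norm_smul]
  exact mul_le_one₀ hc (norm_nonneg _) (hf1 _)

theorem norm_fderiv_fderiv_comp_smul_add_le (hf : ContDiff ℝ 2 f)
    (hf2 : ∀ w, ‖fderiv ℝ (fderiv ℝ f) w‖ ≤ C) {c : ℝ} (hc : |c| ≤ 1) (u w : E) :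
    ‖fderiv ℝ (fderiv ℝ fun w => f (c • w + u)) w‖ ≤ C := by
  rw [hf.fderiv_fderiv_comp_smul_add]
  refine ((ContinuousLinearMap.opNorm_smul_le c (c • fderiv ℝ (fderiv ℝ f) (c • w + u))).trans
    (mul_le_of_le_one_left (norm_nonneg _) hc)).trans ?_
  exact ((ContinuousLinearMap.opNorm_smul_le c (fderiv ℝ (fderiv ℝ f) (c • w + u))).trans
    (mul_le_of_le_one_left (norm_nonneg _) hc)).trans (hf2 _)

theorem ContDiff.hasFDerivAt_fderiv_comp_smul_add_apply (hf : ContDiff ℝ 2 f) (t : ℝ) (u v z : E) :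
    HasFDerivAt (fun z => fderiv ℝ f (t • z + u) v)
      ((t • fderiv ℝ (fderiv ℝ f) (t • z + u)).flip v) z := by
  have hf' : ContDiff ℝ 1 (fderiv ℝ f) := hf.fderiv_right (by norm_num)
  simpa using (hf'.hasFDerivAt_comp_smul_add t u z).clm_apply (hasFDerivAt_const v z)

theorem norm_fderiv_fderiv_comp_smul_add_apply_le (hf : ContDiff ℝ 2 f)
    (hf2 : ∀ w, ‖fderiv ℝ (fderiv ℝ f) w‖ ≤ C) (t : ℝ) (u v z : E) :
    ‖fderiv ℝ (fun z => fderiv ℝ f (t • z + u) v) z‖ ≤ |t| * C * ‖v‖ := by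
  rw [(hf.hasFDerivAt_fderiv_comp_smul_add_apply t u v z).fderiv]
  refine (ContinuousLinearMap.le_opNorm _ _).trans ?_
  rw [ContinuousLinearMap.opNorm_flip]
  refine mul_le_mul_of_nonneg_right ?_ (norm_nonneg v)
  exact (ContinuousLinearMap.opNorm_smul_le t (fderiv ℝ (fderiv ℝ f) (t • z + u))).trans
    (mul_le_mul_of_nonneg_left (hf2 _) (abs_nonneg t))

end SecondOrder

/-! ### Gaussian integration by parts for second derivatives -/

theorem integral_inner_mul_fderiv_stdGaussian {k : ℕ} {f : EuclideanSpace ℝ (Fin k) → ℝ} {C : ℝ}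
    (hf : ContDiff ℝ 2 f) (hf1 : ∀ w, ‖fderiv ℝ f w‖ ≤ 1)
    (hf2 : ∀ w, ‖fderiv ℝ (fderiv ℝ f) w‖ ≤ C) (t : ℝ) (u v : EuclideanSpace ℝ (Fin k)) :
    ∫ z, inner ℝ v z * fderiv ℝ f (t • z + u) v ∂stdGaussian (EuclideanSpace ℝ (Fin k)) =
      t * ∫ z, fderiv ℝ (fderiv ℝ f) (t • z + u) v v
        ∂stdGaussian (EuclideanSpace ℝ (Fin k)) := by
  have hf' : ContDiff ℝ 1 (fderiv ℝ f) := hf.fderiv_right (by norm_num)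
  rw [integral_inner_mul_stdGaussian (C := max ‖v‖ (|t| * C * ‖v‖))
    (g := fun z => fderiv ℝ f (t • z + u) v) (by fun_prop)
    (fun z => le_max_of_le_left (abs_fderiv_apply_le hf1 _ v))
    (fun z => le_max_of_le_right (norm_fderiv_fderiv_comp_smul_add_apply_le hf hf2 t u v z)),
    ← integral_const_mul]
  simp only [(hf.hasFDerivAt_fderiv_comp_smul_add_apply t u v _).fderiv]
  simp

theorem integral_fderiv_apply_stdGaussian {k : ℕ} {f : EuclideanSpace ℝ (Fin k) → ℝ} {C : ℝ}
    (hf : ContDiff ℝ 2 f) (hf1 : ∀ w, ‖fderiv ℝ f w‖ ≤ 1)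
    (hf2 : ∀ w, ‖fderiv ℝ (fderiv ℝ f) w‖ ≤ C) (t : ℝ) (u : EuclideanSpace ℝ (Fin k)) :
    ∫ z, fderiv ℝ f (t • z + u) z ∂stdGaussian (EuclideanSpace ℝ (Fin k)) =
      t * ∫ z, ∑ a, fderiv ℝ (fderiv ℝ f) (t • z + u) (EuclideanSpace.single a 1)
        (EuclideanSpace.single a 1) ∂stdGaussian (EuclideanSpace ℝ (Fin k)) := by
  have hf' : ContDiff ℝ 1 (fderiv ℝ f) := hf.fderiv_right (by norm_num)
  have hf'c : Continuous (fderiv ℝ f) := hf'.continuous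
  have hf''c : Continuous (fderiv ℝ (fderiv ℝ f)) := hf'.continuous_fderiv one_ne_zero
  have hC : 0 ≤ C := (norm_nonneg (fderiv ℝ (fderiv ℝ f) 0)).trans (hf2 0)
  have hexp (z : EuclideanSpace ℝ (Fin k)) : fderiv ℝ f (t • z + u) z =
      ∑ a, inner ℝ (EuclideanSpace.single a (1 : ℝ)) z *
        fderiv ℝ f (t • z + u) (EuclideanSpace.single a 1) := by
    have hz : z = ∑ a, z a • EuclideanSpace.single a (1 : ℝ) := by
      simpa using ((EuclideanSpace.basisFun (Fin k) ℝ).sum_repr z).symm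
    generalize fderiv ℝ f (t • z + u) = l
    conv_lhs => rw [hz]
    simp [EuclideanSpace.inner_single_left]
  simp only [hexp]
  rw [integral_finsetSum, integral_finsetSum, Finset.mul_sum]
  · exact Finset.sum_congr rfl fun a _ =>
      integral_inner_mul_fderiv_stdGaussian hf hf1 hf2 t u _
  · exact fun a _ => Integrable.of_bound (by fun_prop) C (ae_of_all _ fun z =>
      (abs_fderiv_fderiv_apply_le hf2 _ _).trans_eq (by simp))
  · exact fun a _ => integrable_inner_mul_stdGaussian (C := 1) (by fun_prop) (fun z =>
      (abs_fderiv_apply_le hf1 _ _).trans_eq (by simp)) _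

/-! ### Interpolation between the projection and the Gaussian vector -/

/-- The joint law of a random vector with law `μ`, an independent Haar distributed frame, and an
independent standard Gaussian vector in `ℝᵏ`. -/
noncomputable abbrev projGaussianLaw {d k : ℕ} (hk : k ≤ d) (μ : Measure (EuclideanSpace ℝ (Fin d))) :
    Measure ((EuclideanSpace ℝ (Fin d) × Stiefel d k) × EuclideanSpace ℝ (Fin k)) :=
  (μ.prod (stiefelHaar hk)).prod (stdGaussian (EuclideanSpace ℝ (Fin k)))

/-- The projection of the vector `p.1` on the frame `p.2`. -/
noncomputable abbrev frameProj {d k : ℕ} (p : EuclideanSpace ℝ (Fin d) × Stiefel d k) :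
    EuclideanSpace ℝ (Fin k) :=
  stiefelProj p.2 p.1

theorem continuous_frameProj (d k : ℕ) : Continuous (frameProj (d := d) (k := k)) :=
  (continuous_stiefelProj d k).comp continuous_swap

/-- The point `cos s • W + (σ sin s) • z` of the path from the projection `W` to the Gaussian
vector `σ z`. -/
noncomputable abbrev trigInterp {d k : ℕ} (σ s : ℝ)
    (m : (EuclideanSpace ℝ (Fin d) × Stiefel d k) × EuclideanSpace ℝ (Fin k)) :
    EuclideanSpace ℝ (Fin k) :=
  Real.cos s • frameProj m.1 + (σ * Real.sin s) • m.2

@[fun_prop]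
theorem continuous_frameProj_fst (d k : ℕ) : Continuous
    fun m : (EuclideanSpace ℝ (Fin d) × Stiefel d k) × EuclideanSpace ℝ (Fin k) =>
      frameProj m.1 :=
  (continuous_frameProj d k).comp continuous_fst

theorem continuous_trigInterp (d k : ℕ) (σ s : ℝ) :
    Continuous (trigInterp (d := d) (k := k) σ s) := by
  unfold trigInterp
  fun_prop

section Interpolation

variable {d k : ℕ} (hk : k ≤ d) {μ : Measure (EuclideanSpace ℝ (Fin d))} [IsProbabilityMeasure μ]

/-- Every integrand below is dominated by a multiple of `(1 + ‖x‖²) (1 + ‖z‖)`. -/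
theorem integrable_projGaussianLaw_of_le (hμ : Integrable (fun x => ‖x‖ ^ 2) μ) {K : ℝ}
    {F : (EuclideanSpace ℝ (Fin d) × Stiefel d k) × EuclideanSpace ℝ (Fin k) → ℝ}
    (hF : Continuous F) (hFK : ∀ m, |F m| ≤ K * ((1 + ‖m.1.1‖ ^ 2) * (1 + ‖m.2‖))) :
    Integrable F (projGaussianLaw hk μ) := by
  have h1 : Integrable (fun p : EuclideanSpace ℝ (Fin d) × Stiefel d k => 1 + ‖p.1‖ ^ 2)
      (μ.prod (stiefelHaar hk)) := ((integrable_const 1).add hμ).comp_fst _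
  have h2 : Integrable (fun z => 1 + ‖z‖) (stdGaussian (EuclideanSpace ℝ (Fin k))) :=
    (integrable_const 1).add IsGaussian.integrable_id.norm
  exact ((h1.mul_prod h2).const_mul K).mono' hF.aestronglyMeasurable (ae_of_all _ hFK)

theorem hasDerivAt_integral_trigInterp (hμ : Integrable (fun x => ‖x‖ ^ 2) μ)
    {f : EuclideanSpace ℝ (Fin k) → ℝ} (hf : ContDiff ℝ 1 f) (hf1 : ∀ w, ‖fderiv ℝ f w‖ ≤ 1)
    {σ : ℝ} (hσ : 0 < σ) (s : ℝ) :
    HasDerivAt (fun s => ∫ m, f (trigInterp σ s m) ∂projGaussianLaw hk μ)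
      (∫ m, fderiv ℝ f (trigInterp σ s m) (-Real.sin s • frameProj m.1 + (σ * Real.cos s) • m.2)
        ∂projGaussianLaw hk μ) s := by
  have hY (s : ℝ) := continuous_trigInterp d k σ s
  have hf'c : Continuous (fderiv ℝ f) := hf.continuous_fderiv one_ne_zero
  have hx (x : EuclideanSpace ℝ (Fin d)) : ‖x‖ ≤ 1 + ‖x‖ ^ 2 := by nlinarith [sq_nonneg (‖x‖ - 1)]
  have hcomb {a b : ℝ} (ha : |a| ≤ 1) (hb : |b| ≤ 1)
      (m : (EuclideanSpace ℝ (Fin d) × Stiefel d k) × EuclideanSpace ℝ (Fin k)) :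
      ‖a • frameProj m.1 + (σ * b) • m.2‖ ≤ ‖m.1.1‖ + σ * ‖m.2‖ := by
    refine (norm_add_le _ _).trans (add_le_add ?_ ?_)
    · rw [norm_smul, Real.norm_eq_abs]
      exact (mul_le_of_le_one_left (norm_nonneg _) ha).trans (norm_stiefelProj_le _ _)
    · rw [norm_smul, Real.norm_eq_abs, abs_mul, abs_of_pos hσ, mul_assoc]
      gcongr
      exact mul_le_of_le_one_left (norm_nonneg _) hb
  have hdom (m : (EuclideanSpace ℝ (Fin d) × Stiefel d k) × EuclideanSpace ℝ (Fin k)) :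
      ‖m.1.1‖ + σ * ‖m.2‖ ≤ (1 + σ) * ((1 + ‖m.1.1‖ ^ 2) * (1 + ‖m.2‖)) := by
    have := hx m.1.1
    have h1 : 0 ≤ ‖m.1.1‖ ^ 2 * ‖m.2‖ := by positivity
    have h2 : 0 ≤ σ * ‖m.1.1‖ ^ 2 := by positivity
    have h3 : 0 ≤ σ * (‖m.1.1‖ ^ 2 * ‖m.2‖) := by positivity
    nlinarith [norm_nonneg m.2]
  refine (hasDerivAt_integral_of_dominated_loc_of_deriv_le (μ := projGaussianLaw hk μ)
    (F := fun s m => f (trigInterp σ s m))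
    (F' := fun s m => fderiv ℝ f (trigInterp σ s m)
      (-Real.sin s • frameProj m.1 + (σ * Real.cos s) • m.2))
    (bound := fun m => ‖m.1.1‖ + σ * ‖m.2‖) Filter.univ_mem
    (Filter.Eventually.of_forall fun s => (hf.continuous.comp (hY s)).aestronglyMeasurable)
    ?_ ?_ ?_ ?_ ?_).2
  · refine integrable_projGaussianLaw_of_le hk hμ (K := |f 0| + (1 + σ))
      (hf.continuous.comp (hY s)) fun m => ?_
    refine (abs_le_of_norm_fderiv_le (hf.differentiable one_ne_zero) hf1 _).trans ?_
    have h1 := (hcomb (Real.abs_cos_le_one s) (Real.abs_sin_le_one s) m).trans (hdom m)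
    have h2 : |f 0| * 1 ≤ |f 0| * ((1 + ‖m.1.1‖ ^ 2) * (1 + ‖m.2‖)) := by
      gcongr
      nlinarith [norm_nonneg m.2, sq_nonneg ‖m.1.1‖, mul_nonneg (sq_nonneg ‖m.1.1‖) (norm_nonneg m.2)]
    linarith
  · exact ((hf'c.comp (hY s)).clm_apply (by fun_prop)).aestronglyMeasurable
  · refine ae_of_all _ fun m s _ => (ContinuousLinearMap.le_opNorm _ _).trans ?_
    refine (mul_le_of_le_one_left (norm_nonneg _) (hf1 _)).trans ?_
    exact hcomb (by rw [abs_neg]; exact Real.abs_sin_le_one s) (Real.abs_cos_le_one s) m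
  · refine integrable_projGaussianLaw_of_le hk hμ (K := 1 + σ) (by fun_prop) fun m => ?_
    rw [abs_of_nonneg (by positivity)]
    exact hdom m
  · exact ae_of_all _ fun m s _ => (hf.differentiable one_ne_zero _).hasFDerivAt.comp_hasDerivAt s
      (((Real.hasDerivAt_cos s).smul_const _).add (((Real.hasDerivAt_sin s).const_mul σ).smul_const _))

/-- The identity behind the bound: the mean-zero Laplacian on the sphere and two Gaussian
integrations by parts remove all second derivatives from the derivative of the interpolation. -/
theorem integral_fderiv_trigInterp (hμ : Integrable (fun x => ‖x‖ ^ 2) μ)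
    {f : EuclideanSpace ℝ (Fin k) → ℝ} {C : ℝ} (hf : ContDiff ℝ 2 f)
    (hf1 : ∀ w, ‖fderiv ℝ f w‖ ≤ 1) (hf2 : ∀ w, ‖fderiv ℝ (fderiv ℝ f) w‖ ≤ C)
    {σ : ℝ} (hσ : 0 < σ) {s : ℝ} (hc : Real.cos s ≠ 0) :
    ((d : ℝ) - 1) * ∫ m, fderiv ℝ f (trigInterp σ s m)
        (-Real.sin s • frameProj m.1 + (σ * Real.cos s) • m.2) ∂projGaussianLaw hk μ =
      Real.cos s / σ * ∫ m, ((((d : ℝ) - 1) * σ ^ 2 - ‖m.1.1‖ ^ 2) *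
          fderiv ℝ f (trigInterp σ s m) m.2 +
        inner ℝ (frameProj m.1) m.2 * fderiv ℝ f (trigInterp σ s m) (frameProj m.1))
        ∂projGaussianLaw hk μ := by
  have hC : 0 ≤ C := (norm_nonneg (fderiv ℝ (fderiv ℝ f) 0)).trans (hf2 0)
  have hf' : ContDiff ℝ 1 (fderiv ℝ f) := hf.fderiv_right (by norm_num)
  have hf'' : Continuous (fderiv ℝ (fderiv ℝ f)) := hf'.continuous_fderiv one_ne_zero
  have hW := continuous_frameProj_fst d k
  have hY := continuous_trigInterp d k σ s
  have hD1 := hf'.continuous.comp hY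
  have hD2 := hf''.comp hY
  have hWn (m : (EuclideanSpace ℝ (Fin d) × Stiefel d k) × EuclideanSpace ℝ (Fin k)) :
      ‖frameProj m.1‖ ≤ ‖m.1.1‖ := norm_stiefelProj_le _ _
  have h1a := abs_fderiv_apply_le hf1
  have h2a := abs_fderiv_fderiv_apply_le hf2
  -- Integrability of the five terms that occur.
  have hia : Integrable (fun m => fderiv ℝ f (trigInterp σ s m) (frameProj m.1))
      (projGaussianLaw hk μ) := by
    refine integrable_projGaussianLaw_of_le hk hμ (K := 1) (hD1.clm_apply hW) fun m => ?_
    have h := (h1a (trigInterp σ s m) (frameProj m.1)).trans (hWn m)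
    nlinarith [sq_nonneg (‖m.1.1‖ - 1), norm_nonneg m.2,
      mul_nonneg (sq_nonneg ‖m.1.1‖) (norm_nonneg m.2)]
  have hib : Integrable (fun m => fderiv ℝ f (trigInterp σ s m) m.2) (projGaussianLaw hk μ) := by
    refine integrable_projGaussianLaw_of_le hk hμ (K := 1) (hD1.clm_apply continuous_snd) fun m => ?_
    have h := h1a (trigInterp σ s m) m.2
    nlinarith [sq_nonneg ‖m.1.1‖, norm_nonneg m.2,
      mul_nonneg (sq_nonneg ‖m.1.1‖) (norm_nonneg m.2)]
  have hRb : Integrable (fun m => ‖m.1.1‖ ^ 2 * fderiv ℝ f (trigInterp σ s m) m.2)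
      (projGaussianLaw hk μ) := by
    refine integrable_projGaussianLaw_of_le hk hμ (K := 1)
      ((by fun_prop : Continuous _).mul (hD1.clm_apply continuous_snd)) fun m => ?_
    rw [abs_mul, abs_of_nonneg (sq_nonneg ‖m.1.1‖)]
    have h := mul_le_mul_of_nonneg_left (h1a (trigInterp σ s m) m.2) (sq_nonneg ‖m.1.1‖)
    nlinarith [sq_nonneg ‖m.1.1‖, norm_nonneg m.2]
  have hiΔ : Integrable (fun m => ‖m.1.1‖ ^ 2 * ∑ a, fderiv ℝ (fderiv ℝ f) (trigInterp σ s m)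
      (EuclideanSpace.single a 1) (EuclideanSpace.single a 1)) (projGaussianLaw hk μ) := by
    refine integrable_projGaussianLaw_of_le hk hμ (K := k * C)
      ((by fun_prop : Continuous _).mul (continuous_finsetSum _ fun a _ =>
        (hD2.clm_apply continuous_const).clm_apply continuous_const)) fun m => ?_
    rw [abs_mul, abs_of_nonneg (sq_nonneg ‖m.1.1‖)]
    have h : |∑ a, fderiv ℝ (fderiv ℝ f) (trigInterp σ s m) (EuclideanSpace.single a 1)
        (EuclideanSpace.single a 1)| ≤ k * C := by
      refine (Finset.abs_sum_le_sum_abs _ _).trans ?_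
      refine (Finset.sum_le_sum fun a _ => h2a _ _).trans_eq ?_
      simp
    calc _ ≤ ‖m.1.1‖ ^ 2 * (k * C) := by gcongr
      _ = k * C * (‖m.1.1‖ ^ 2 * 1) := by ring
      _ ≤ k * C * ((1 + ‖m.1.1‖ ^ 2) * (1 + ‖m.2‖)) := by
        gcongr <;> simp
  have hih : Integrable (fun m => fderiv ℝ (fderiv ℝ f) (trigInterp σ s m) (frameProj m.1)
      (frameProj m.1)) (projGaussianLaw hk μ) := by
    refine integrable_projGaussianLaw_of_le hk hμ (K := C)
      ((hD2.clm_apply hW).clm_apply hW) fun m => (h2a _ _).trans ?_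
    gcongr
    have h := pow_le_pow_left₀ (norm_nonneg _) (hWn m) 2
    nlinarith [norm_nonneg m.2, mul_nonneg (sq_nonneg ‖m.1.1‖) (norm_nonneg m.2)]
  have hig : Integrable (fun m => inner ℝ (frameProj m.1) m.2 *
      fderiv ℝ f (trigInterp σ s m) (frameProj m.1)) (projGaussianLaw hk μ) := by
    refine integrable_projGaussianLaw_of_le hk hμ (K := 1)
      ((hW.inner continuous_snd).mul (hD1.clm_apply hW)) fun m => ?_
    rw [abs_mul]
    calc _ ≤ (‖m.1.1‖ * ‖m.2‖) * ‖m.1.1‖ := by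
          gcongr
          · exact (abs_real_inner_le_norm _ _).trans (by gcongr; exact hWn m)
          · exact (h1a _ _).trans (hWn m)
      _ ≤ _ := by nlinarith [norm_nonneg m.2, sq_nonneg ‖m.1.1‖]
  -- The spherical identity, applied to `w ↦ f (cos s • w + (σ sin s) • z)` for each `z`.
  have hsphere : ∫ m, (Real.cos s ^ 2 * (‖m.1.1‖ ^ 2 * ∑ a, fderiv ℝ (fderiv ℝ f)
        (trigInterp σ s m) (EuclideanSpace.single a 1) (EuclideanSpace.single a 1))
      - Real.cos s ^ 2 * fderiv ℝ (fderiv ℝ f) (trigInterp σ s m) (frameProj m.1) (frameProj m.1)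
      - ((d : ℝ) - 1) * Real.cos s * fderiv ℝ f (trigInterp σ s m) (frameProj m.1))
        ∂projGaussianLaw hk μ = 0 := by
    have hI := ((hiΔ.const_mul (Real.cos s ^ 2)).sub (hih.const_mul (Real.cos s ^ 2))).sub
      (hia.const_mul (((d : ℝ) - 1) * Real.cos s))
    refine (integral_prod_symm _ hI).trans (integral_eq_zero_of_ae ?_)
    filter_upwards [hI.prod_left_ae] with z hz
    refine (integral_prod _ hz).trans (integral_eq_zero_of_ae (ae_of_all _ fun x => ?_))
    set u := (σ * Real.sin s) • z with hu
    have hcos := Real.abs_cos_le_one s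
    have h := integral_stiefelProj_laplacian hk (φ := fun w => f (Real.cos s • w + u))
      (C := max 1 C) (hf.comp (by fun_prop))
      (fun w => le_max_of_le_left (norm_fderiv_comp_smul_add_le hf hf1 hcos u w))
      (fun w => le_max_of_le_right (norm_fderiv_fderiv_comp_smul_add_le hf hf2 hcos u w)) x
    rw [hf.fderiv_fderiv_comp_smul_add, (hf.of_le one_le_two).fderiv_comp_smul_add] at h
    refine (integral_congr_ae (ae_of_all _ fun θ => ?_)).trans h
    simp only [Pi.sub_apply, smul_apply, smul_eq_mul, ← Finset.mul_sum, trigInterp, frameProj, ← hu]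
    ring
  -- Gaussian integration by parts for fixed vector and frame.
  have hgauss1 : ∫ m, ‖m.1.1‖ ^ 2 * fderiv ℝ f (trigInterp σ s m) m.2 ∂projGaussianLaw hk μ =
      σ * Real.sin s * ∫ m, ‖m.1.1‖ ^ 2 * ∑ a, fderiv ℝ (fderiv ℝ f) (trigInterp σ s m)
        (EuclideanSpace.single a 1) (EuclideanSpace.single a 1) ∂projGaussianLaw hk μ := by
    rw [integral_prod _ hRb, integral_prod _ hiΔ, ← integral_const_mul]
    congr 1
    funext p
    dsimp only
    rw [integral_const_mul, integral_const_mul]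
    have h := integral_fderiv_apply_stdGaussian hf hf1 hf2 (σ * Real.sin s)
      (Real.cos s • frameProj p)
    simp only [trigInterp, add_comm (Real.cos s • frameProj p)]
    rw [h]
    ring
  have hgauss2 : ∫ m, inner ℝ (frameProj m.1) m.2 *
        fderiv ℝ f (trigInterp σ s m) (frameProj m.1) ∂projGaussianLaw hk μ =
      σ * Real.sin s * ∫ m, fderiv ℝ (fderiv ℝ f) (trigInterp σ s m) (frameProj m.1)
        (frameProj m.1) ∂projGaussianLaw hk μ := by
    rw [integral_prod _ hig, integral_prod _ hih, ← integral_const_mul]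
    congr 1
    funext p
    simp only [trigInterp, add_comm (Real.cos s • frameProj p)]
    exact integral_inner_mul_fderiv_stdGaussian hf hf1 hf2 _ _ _
  have hsub := integral_sub' ((hiΔ.const_mul (Real.cos s ^ 2)).sub (hih.const_mul (Real.cos s ^ 2)))
    (hia.const_mul (((d : ℝ) - 1) * Real.cos s))
  rw [integral_sub' (hiΔ.const_mul _) (hih.const_mul _)] at hsub
  replace hsphere := hsub.symm.trans hsphere
  have hleft := integral_add' (hia.const_mul (-Real.sin s)) (hib.const_mul (σ * Real.cos s))
  have hright := integral_add' ((hib.const_mul (((d : ℝ) - 1) * σ ^ 2)).sub hRb) hig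
  rw [integral_sub' (hib.const_mul _) hRb] at hright
  simp only [Pi.add_apply, Pi.sub_apply, integral_const_mul] at hsphere hleft hright
  simp only [map_add, map_smul, smul_eq_mul, sub_mul _ _ (fderiv ℝ f _ _)]
  rw [hleft, hright, hgauss1, hgauss2]
  field_simp
  refine mul_left_cancel₀ hc ?_
  linear_combination (Real.sin s) * hsphere

end Interpolation

/-! ### The Wasserstein bound -/

theorem integral_norm_stdGaussian_le (k : ℕ) :
    ∫ z, ‖z‖ ∂stdGaussian (EuclideanSpace ℝ (Fin k)) ≤ √(k : ℝ) := by
  refine integral_le_of_integral_sq_le IsGaussian.memLp_two_id.norm (Real.sqrt_nonneg _) ?_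
  rw [Real.sq_sqrt (Nat.cast_nonneg k)]
  exact (integral_norm_sq_stdGaussian k).le

theorem integral_abs_inner_stdGaussian_le {k : ℕ} (v : EuclideanSpace ℝ (Fin k)) :
    ∫ z, |inner ℝ v z| ∂stdGaussian (EuclideanSpace ℝ (Fin k)) ≤ ‖v‖ := by
  refine integral_le_of_integral_sq_le (IsGaussian.memLp_two_id.const_inner v).abs
    (norm_nonneg v) ?_
  simp only [sq_abs]
  exact (integral_inner_sq_stdGaussian v).le

section Bound

variable {d k : ℕ} (hk : k ≤ d) {μ : Measure (EuclideanSpace ℝ (Fin d))} [IsProbabilityMeasure μ]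

theorem integral_norm_sq_frameProj (hμ : Integrable (fun x => ‖x‖ ^ 2) μ) :
    Integrable (fun p => ‖frameProj p‖ ^ 2) (μ.prod (stiefelHaar hk)) ∧
    d * ∫ p, ‖frameProj p‖ ^ 2 ∂μ.prod (stiefelHaar hk) = k * ∫ x, ‖x‖ ^ 2 ∂μ := by
  have hi : Integrable (fun p => ‖frameProj p‖ ^ 2) (μ.prod (stiefelHaar hk)) := by
    refine (hμ.comp_fst (stiefelHaar hk)).mono'
      ((continuous_frameProj d k).norm.pow 2).aestronglyMeasurable (ae_of_all _ fun p => ?_)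
    rw [Real.norm_of_nonneg (by positivity)]
    exact pow_le_pow_left₀ (norm_nonneg _) (norm_stiefelProj_le _ _) 2
  refine ⟨hi, ?_⟩
  rw [integral_prod _ hi, ← integral_const_mul, ← integral_const_mul]
  exact integral_congr_ae (ae_of_all _ fun x => integral_norm_sq_stiefelProj hk x)

/-- The bound on the derivative of the interpolation, for a test function with bounded first and
second derivatives; only the bound on the first derivative enters the constant. -/
theorem abs_integral_fderiv_trigInterp_le (hd : 2 ≤ d) {σ : ℝ} (hσ : 0 < σ)
    (hμ : Integrable (fun x => ‖x‖ ^ 2) μ) (hμσ : ∫ x, ‖x‖ ^ 2 ∂μ = σ ^ 2 * d)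
    {f : EuclideanSpace ℝ (Fin k) → ℝ} {C : ℝ} (hf : ContDiff ℝ 2 f)
    (hf1 : ∀ w, ‖fderiv ℝ f w‖ ≤ 1) (hf2 : ∀ w, ‖fderiv ℝ (fderiv ℝ f) w‖ ≤ C)
    {s : ℝ} (hc : 0 < Real.cos s) :
    |∫ m, fderiv ℝ f (trigInterp σ s m)
        (-Real.sin s • frameProj m.1 + (σ * Real.cos s) • m.2) ∂projGaussianLaw hk μ| ≤
      (√(k : ℝ) * (∫ x, |‖x‖ ^ 2 - σ ^ 2 * d| ∂μ + σ ^ 2) + σ ^ 2 * k) / (σ * ((d : ℝ) - 1)) *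
        Real.cos s := by
  have hd1 : (0 : ℝ) < (d : ℝ) - 1 := by
    have : (2 : ℝ) ≤ d := by exact_mod_cast hd
    linarith
  have hid := integral_fderiv_trigInterp hk hμ hf hf1 hf2 hσ hc.ne'
  have hN : Integrable (fun z : EuclideanSpace ℝ (Fin k) => ‖z‖) (stdGaussian _) :=
    IsGaussian.integrable_id.norm
  have hR : Integrable (fun x => |((d : ℝ) - 1) * σ ^ 2 - ‖x‖ ^ 2|) μ :=
    ((integrable_const _).sub hμ).abs
  have hi1 : Integrable (fun m : (EuclideanSpace ℝ (Fin d) × Stiefel d k) ×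
      EuclideanSpace ℝ (Fin k) => |((d : ℝ) - 1) * σ ^ 2 - ‖m.1.1‖ ^ 2| * ‖m.2‖)
      (projGaussianLaw hk μ) := (hR.comp_fst (stiefelHaar hk)).mul_prod hN
  have hi2 : Integrable (fun m : (EuclideanSpace ℝ (Fin d) × Stiefel d k) ×
      EuclideanSpace ℝ (Fin k) => |inner ℝ (frameProj m.1) m.2| * ‖frameProj m.1‖)
      (projGaussianLaw hk μ) := by
    have hW := continuous_frameProj_fst d k
    refine ((integral_norm_sq_frameProj hk hμ).1.mul_prod hN).mono'
      ((hW.inner continuous_snd).abs.mul hW.norm).aestronglyMeasurable (ae_of_all _ fun m => ?_)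
    rw [Real.norm_of_nonneg (by positivity)]
    calc _ ≤ (‖frameProj m.1‖ * ‖m.2‖) * ‖frameProj m.1‖ := by
          gcongr
          exact abs_real_inner_le_norm _ _
      _ = _ := by ring
  have hle1 : ∫ m, |((d : ℝ) - 1) * σ ^ 2 - ‖m.1.1‖ ^ 2| * ‖m.2‖ ∂projGaussianLaw hk μ ≤
      (∫ x, |‖x‖ ^ 2 - σ ^ 2 * d| ∂μ + σ ^ 2) * √(k : ℝ) := by
    rw [integral_prod_mul (f := fun p : EuclideanSpace ℝ (Fin d) × Stiefel d k =>
      |((d : ℝ) - 1) * σ ^ 2 - ‖p.1‖ ^ 2|) (g := fun z => ‖z‖),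
      integral_fun_fst (f := fun x : EuclideanSpace ℝ (Fin d) =>
        |((d : ℝ) - 1) * σ ^ 2 - ‖x‖ ^ 2|)]
    simp only [probReal_univ, one_smul]
    refine mul_le_mul ?_ (integral_norm_stdGaussian_le k)
      (integral_nonneg fun _ => norm_nonneg _) (by positivity)
    have hA : Integrable (fun x => |‖x‖ ^ 2 - σ ^ 2 * d|) μ := (hμ.sub (integrable_const _)).abs
    calc _ ≤ ∫ x, (|‖x‖ ^ 2 - σ ^ 2 * d| + σ ^ 2) ∂μ := by
          refine integral_mono hR (hA.add (integrable_const _)) fun x => ?_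
          have h : ((d : ℝ) - 1) * σ ^ 2 - ‖x‖ ^ 2 = -(‖x‖ ^ 2 - σ ^ 2 * d) - σ ^ 2 := by ring
          simp only [h]
          refine (abs_sub _ _).trans_eq ?_
          rw [abs_neg, abs_of_nonneg (sq_nonneg σ)]
      _ = _ := by
          rw [integral_add hA (integrable_const _)]
          simp
  have hle2 : ∫ m, |inner ℝ (frameProj m.1) m.2| * ‖frameProj m.1‖ ∂projGaussianLaw hk μ ≤
      σ ^ 2 * k := by
    obtain ⟨hWi, hWe⟩ := integral_norm_sq_frameProj hk hμ
    calc _ ≤ ∫ p, ‖frameProj p‖ ^ 2 ∂μ.prod (stiefelHaar hk) := by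
          rw [integral_prod _ hi2]
          refine integral_mono hi2.integral_prod_left hWi fun p => ?_
          simp only [integral_mul_const]
          rw [sq]
          gcongr
          exact integral_abs_inner_stdGaussian_le _
      _ = σ ^ 2 * k := by
          rw [hμσ] at hWe
          refine mul_left_cancel₀ (by positivity : (d : ℝ) ≠ 0) (hWe.trans ?_)
          ring
  have hmain := norm_integral_le_of_norm_le (μ := projGaussianLaw hk μ) (hi1.add hi2)
    (f := fun m => (((d : ℝ) - 1) * σ ^ 2 - ‖m.1.1‖ ^ 2) * fderiv ℝ f (trigInterp σ s m) m.2 +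
        inner ℝ (frameProj m.1) m.2 * fderiv ℝ f (trigInterp σ s m) (frameProj m.1))
    (ae_of_all _ fun m => by
      refine (norm_add_le _ _).trans (add_le_add ?_ ?_)
      all_goals
        rw [norm_mul]
        exact mul_le_mul_of_nonneg_left (abs_fderiv_apply_le hf1 _ _) (norm_nonneg _))
  rw [integral_add' hi1 hi2, Real.norm_eq_abs] at hmain
  have habs := congrArg abs hid
  rw [abs_mul, abs_mul, abs_of_pos hd1, abs_of_pos (div_pos hc hσ)] at habs
  refine le_of_mul_le_mul_left (habs.le.trans ?_) hd1
  calc _ ≤ Real.cos s / σ * ((∫ x, |‖x‖ ^ 2 - σ ^ 2 * d| ∂μ + σ ^ 2) * √(k : ℝ) + σ ^ 2 * k) := by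
        gcongr
        linarith
    _ = _ := by
        field_simp

/-- Integrating the derivative over `[0, π / 2]`, where `∫ cos = 1`. -/
theorem abs_integral_smooth_sub_le (hd : 2 ≤ d) {σ : ℝ} (hσ : 0 < σ)
    (hμ : Integrable (fun x => ‖x‖ ^ 2) μ) (hμσ : ∫ x, ‖x‖ ^ 2 ∂μ = σ ^ 2 * d)
    {f : EuclideanSpace ℝ (Fin k) → ℝ} {C : ℝ} (hf : ContDiff ℝ 2 f)
    (hf1 : ∀ w, ‖fderiv ℝ f w‖ ≤ 1) (hf2 : ∀ w, ‖fderiv ℝ (fderiv ℝ f) w‖ ≤ C) :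
    |∫ m, f (σ • m.2) ∂projGaussianLaw hk μ - ∫ m, f (frameProj m.1) ∂projGaussianLaw hk μ| ≤
      (√(k : ℝ) * (∫ x, |‖x‖ ^ 2 - σ ^ 2 * d| ∂μ + σ ^ 2) + σ ^ 2 * k) / (σ * ((d : ℝ) - 1)) := by
  set K := (√(k : ℝ) * (∫ x, |‖x‖ ^ 2 - σ ^ 2 * d| ∂μ + σ ^ 2) + σ ^ 2 * k) / (σ * ((d : ℝ) - 1))
  have hder := hasDerivAt_integral_trigInterp hk hμ (hf.of_le one_le_two) hf1 hσ
  set Ψ : ℝ → ℝ := fun s => ∫ m, f (trigInterp σ s m) ∂projGaussianLaw hk μ with hΨ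
  have h := image_norm_le_of_norm_deriv_right_le_deriv_boundary (a := 0) (b := Real.pi / 2)
    (f := fun s => Ψ s - Ψ 0) (B := fun s => K * Real.sin s) (B' := fun s => K * Real.cos s)
    (fun s _ => ((hder s).sub_const _).continuousAt.continuousWithinAt)
    (fun s _ => ((hder s).sub_const _).hasDerivWithinAt) (by simp)
    (fun s => (Real.hasDerivAt_sin s).const_mul K)
    (fun s hs => abs_integral_fderiv_trigInterp_le hk hd hσ hμ hμσ hf hf1 hf2
      (Real.cos_pos_of_mem_Ioo ⟨by linarith [hs.1, Real.pi_pos], hs.2⟩))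
    (Set.right_mem_Icc.2 (by positivity))
  simpa [hΨ, trigInterp] using h

theorem integrable_lipschitz_frameProj (hμ : Integrable (fun x => ‖x‖ ^ 2) μ)
    {f : EuclideanSpace ℝ (Fin k) → ℝ} (hf : LipschitzWith 1 f) :
    Integrable (fun m => f (frameProj m.1)) (projGaussianLaw hk μ) := by
  refine integrable_projGaussianLaw_of_le hk hμ (K := |f 0| + 1)
    (hf.continuous.comp (continuous_frameProj_fst d k)) fun m => ?_
  have h := hf.dist_le_mul (frameProj m.1) 0
  rw [Real.dist_eq, dist_zero_right, NNReal.coe_one, one_mul] at h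
  have h2 : ‖frameProj m.1‖ ≤ ‖m.1.1‖ := norm_stiefelProj_le _ _
  have h3 := abs_sub_abs_le_abs_sub (f (frameProj m.1)) (f 0)
  have h4 : ‖m.1.1‖ ≤ 1 + ‖m.1.1‖ ^ 2 := by nlinarith [sq_nonneg (‖m.1.1‖ - 1)]
  have h5 : 1 + ‖m.1.1‖ ^ 2 ≤ (1 + ‖m.1.1‖ ^ 2) * (1 + ‖m.2‖) :=
    le_mul_of_one_le_right (by positivity) (by simp)
  have h6 : |f 0| * 1 ≤ |f 0| * ((1 + ‖m.1.1‖ ^ 2) * (1 + ‖m.2‖)) := by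
    gcongr
    nlinarith [sq_nonneg ‖m.1.1‖]
  linarith

theorem integrable_lipschitz_smul_snd (hμ : Integrable (fun x => ‖x‖ ^ 2) μ)
    {f : EuclideanSpace ℝ (Fin k) → ℝ} (hf : LipschitzWith 1 f) (σ : ℝ) :
    Integrable (fun m => f (σ • m.2)) (projGaussianLaw hk μ) := by
  refine integrable_projGaussianLaw_of_le hk hμ (K := |f 0| + |σ|)
    (hf.continuous.comp (by fun_prop)) fun m => ?_
  have h := hf.dist_le_mul (σ • m.2) 0
  rw [Real.dist_eq, dist_zero_right, NNReal.coe_one, one_mul, norm_smul, Real.norm_eq_abs] at h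
  have h3 := abs_sub_abs_le_abs_sub (f (σ • m.2)) (f 0)
  have h5 : 1 + ‖m.2‖ ≤ (1 + ‖m.1.1‖ ^ 2) * (1 + ‖m.2‖) :=
    le_mul_of_one_le_left (by positivity) (by simp)
  calc _ ≤ |f 0| * 1 + |σ| * ‖m.2‖ := by linarith
    _ ≤ |f 0| * ((1 + ‖m.1.1‖ ^ 2) * (1 + ‖m.2‖)) +
        |σ| * ((1 + ‖m.1.1‖ ^ 2) * (1 + ‖m.2‖)) := by
      gcongr
      · linarith [norm_nonneg m.2]
      · linarith
    _ = _ := by ring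

theorem abs_integral_lipschitz_sub_le (hd : 2 ≤ d) {σ : ℝ} (hσ : 0 < σ)
    (hμ : Integrable (fun x => ‖x‖ ^ 2) μ) (hμσ : ∫ x, ‖x‖ ^ 2 ∂μ = σ ^ 2 * d)
    {f : EuclideanSpace ℝ (Fin k) → ℝ} (hf : LipschitzWith 1 f) :
    |∫ m, f (σ • m.2) ∂projGaussianLaw hk μ - ∫ m, f (frameProj m.1) ∂projGaussianLaw hk μ| ≤
      (√(k : ℝ) * (∫ x, |‖x‖ ^ 2 - σ ^ 2 * d| ∂μ + σ ^ 2) + σ ^ 2 * k) / (σ * ((d : ℝ) - 1)) := by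
  refine le_of_forall_pos_le_add fun ε hε => ?_
  obtain ⟨g, C, hg, hgf, hg1, hg2⟩ := hf.exists_contDiff_approx (half_pos hε)
  have hgl : LipschitzWith 1 g := by
    refine lipschitzWith_of_nnnorm_fderiv_le (𝕜 := ℝ) (hg.differentiable two_ne_zero) fun w => ?_
    exact_mod_cast hg1 w
  have hclose {Y : (EuclideanSpace ℝ (Fin d) × Stiefel d k) × EuclideanSpace ℝ (Fin k) →
      EuclideanSpace ℝ (Fin k)} (h1 : Integrable (fun m => g (Y m)) (projGaussianLaw hk μ))
      (h2 : Integrable (fun m => f (Y m)) (projGaussianLaw hk μ)) :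
      |∫ m, g (Y m) ∂projGaussianLaw hk μ - ∫ m, f (Y m) ∂projGaussianLaw hk μ| ≤ ε / 2 := by
    rw [← integral_sub h1 h2]
    simpa using norm_integral_le_of_norm_le_const (μ := projGaussianLaw hk μ)
      (f := fun m => g (Y m) - f (Y m)) (ae_of_all _ fun m => hgf (Y m))
  have hZ := abs_le.1 (hclose (integrable_lipschitz_smul_snd hk hμ hgl σ)
    (integrable_lipschitz_smul_snd hk hμ hf σ))
  have hW := abs_le.1 (hclose (integrable_lipschitz_frameProj hk hμ hgl)
    (integrable_lipschitz_frameProj hk hμ hf))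
  have hmain := abs_le.1 (abs_integral_smooth_sub_le hk hd hσ hμ hμσ hg hg1 hg2)
  exact abs_le.2 ⟨by linarith [hZ.1, hZ.2, hW.1, hW.2, hmain.1],
    by linarith [hZ.1, hZ.2, hW.1, hW.2, hmain.2]⟩

end Bound

theorem theorem2p1 {d k : ℕ} (hd : 2 ≤ d) (hk : k ≤ d)
    {Ω : Type*} [MeasurableSpace Ω] (P : Measure Ω) [IsProbabilityMeasure P]
    {Ω' : Type*} [MeasurableSpace Ω'] (P' : Measure Ω') [IsProbabilityMeasure P']
    (X : Ω → EuclideanSpace ℝ (Fin d)) (θ : Ω → Stiefel d k)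
    (Z : Ω' → EuclideanSpace ℝ (Fin k)) (σ A : ℝ) (hσ : 0 < σ)
    (hX : MemLp X 2 P)
    (hX_mean : ∫ ω, X ω ∂P = 0)
    (hX_sq : ∫ ω, ‖X ω‖ ^ 2 ∂P = σ ^ 2 * d)
    (hA : A = ∫ ω, |‖X ω‖ ^ 2 * (σ ^ 2)⁻¹ - d| ∂P)
    (hθ : HasLaw θ (stiefelHaar hk) P)
    (hindep : IndepFun X θ P)
    (hZ : HasLaw Z (stdGaussian (EuclideanSpace ℝ (Fin k))) P') :
    wassersteinDist (fun ω => stiefelProj (θ ω) (X ω)) P (fun ω => σ • Z ω) P' ≤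
      ENNReal.ofReal ((σ * √(k : ℝ) * (A + 1) + σ * k) / ((d : ℝ) - 1)) := by
  have hXm : AEMeasurable X P := hX.aestronglyMeasurable.aemeasurable
  set μ := P.map X with hμdef
  have : IsProbabilityMeasure μ := Measure.isProbabilityMeasure_map hXm
  have hjoint : P.map (fun ω => (X ω, θ ω)) = μ.prod (stiefelHaar hk) := by
    rw [(indepFun_iff_map_prod_eq_prod_map_map hXm hθ.aemeasurable).1 hindep, hθ.map_eq]
  have hμ : Integrable (fun x => ‖x‖ ^ 2) μ :=
    (integrable_map_measure (by fun_prop) hXm).2 hX.integrable_norm_pow'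
  have hμσ : ∫ x, ‖x‖ ^ 2 ∂μ = σ ^ 2 * d := by
    rw [hμdef, integral_map hXm (by fun_prop), hX_sq]
  have hμA : ∫ x, |‖x‖ ^ 2 - σ ^ 2 * d| ∂μ = σ ^ 2 * A := by
    rw [hμdef, integral_map hXm (by fun_prop), hA, ← integral_const_mul]
    congr 1
    funext ω
    rw [← abs_of_pos (pow_pos hσ 2), ← abs_mul, abs_of_pos (pow_pos hσ 2)]
    congr 1
    field_simp
  refine iSup₂_le fun f hf => ENNReal.ofReal_le_ofReal ?_
  have h := abs_integral_lipschitz_sub_le hk hd hσ hμ hμσ hf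
  have hfZ : Continuous fun z => f (σ • z) := hf.continuous.comp (by fun_prop)
  have hfW : Continuous fun p : EuclideanSpace ℝ (Fin d) × Stiefel d k => f (frameProj p) :=
    hf.continuous.comp (continuous_frameProj d k)
  have hZint : ∫ ω, f (σ • Z ω) ∂P' = ∫ m, f (σ • m.2) ∂projGaussianLaw hk μ := by
    rw [integral_fun_snd (f := fun z : EuclideanSpace ℝ (Fin k) => f (σ • z)), probReal_univ,
      one_smul, ← hZ.map_eq, integral_map hZ.aemeasurable hfZ.aestronglyMeasurable]
  have hXint : ∫ ω, f (stiefelProj (θ ω) (X ω)) ∂P =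
      ∫ m, f (frameProj m.1) ∂projGaussianLaw hk μ := by
    rw [integral_fun_fst (f := fun p : EuclideanSpace ℝ (Fin d) × Stiefel d k => f (frameProj p)),
      probReal_univ, one_smul, ← hjoint, integral_map (hXm.prodMk hθ.aemeasurable)
        hfW.aestronglyMeasurable]
  rw [hZint, hXint]
  refine h.trans_eq ?_
  rw [hμA]
  field_simp
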